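/- Consider full conjunctive queries without self-joins, $Q = R_1(\mathbb{A}_1) \bowtie \dots \bowtie R_m(\mathbb{A}_m)$ with $m \ge 1$, where each $\mathbb{A}_i$ is a finite set of attributes and each attribute $A$ has a nonempty, linearly ordered, possibly infinite domain $\Sigma^A$. A database $\mathcal{D}$ assigns to each $R_i$ a finite bag of tuples from $\Sigma^{\mathbb{A}_i}$; $n$ is the total number of tuples, and $Q(\mathcal{D})$ is the natural join under bag semantics. For a tuple $t\in\Sigma^{\mathbb{A}_i}$ of the domain of $R_i$ let $$TSens(t) = \max\bigl(|Q(\mathcal{D}\cup\{t\})\,\Delta\,Q(\mathcal{D})|,\ |Q(\mathcal{D})\,\Delta\,Q(\mathcal{D}\setminus\{t\})|\bigr),$$ where one copy of $t$ is added to, or removed from, $R_i$. The local sensitivity is $LS(Q,\mathcal{D}) = \max_t TSens(t)$, over all tuples of the domains of all $m$ relations. $Q$ is acyclic if repeatedly removing ears (GYO decomposition) empties the hypergraph with hyperedges $\mathbb{A}_1,\dots,\mathbb{A}_m$; here $h$ is an ear if those of its vertices that belong to other remaining hyperedges are all contained in a single other one, $h'$. A join tree of $Q$ is a rooted tree whose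 nodes are $R_1,\dots,R_m$ such that $\mathbb{A}_i\cap\mathbb{A}_j$ is contained in every relation on the path from $R_i$ to $R_j$. Algorithm LSAcyclicJoin takes a join tree $\mathcal{T}$ of $Q$ and $\mathcal{D}$. All tables carry a column of counts; $\widetilde{\bowtie}$ is the natural join multiplying counts, performed table by table with sort-merge joins (the join of no tables is the table whose only row is the empty tuple, with count $1$), and $\gamma_{\mathbb{A}}$ groups by those attributes of $\mathbb{A}$ that the table has, adding counts, by sorting. With $p(R_i)$ the parent and $C(R_i)$ the children of $R_i$, it computes 1. in post-order, the botjoins $\bot(R_i) = \gamma_{\mathbb{A}_i\cap\mathbb{A}_{p(R_i)}}\widetilde{\bowtie}(R_i,\{\bot(R_j) : R_j\in C(R_i)\})$ (grouping by $\mathbb{A}_i$ at the root); 2. in pre-order, for $R_i$ other than the root, the topjoins $\top(R_i) = \gamma_{\mathbb{A}_i\cap\mathbb{A}_{p(R_i)}}\widetilde{\bowtie}(p(R_i),\top(p(R_i)),\{\bot(R_j) : R_j \in C(p(R_i))\setminus\{R_i\}\})$, where $\top(p(R_i))$ is omitted if $p(R_i)$ is the root; 3. the multiplicity tables $T^i =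 \gamma_{\mathbb{A}_i}\widetilde{\bowtie}(\top(R_i),\{\bot(R_j) : R_j\in C(R_i)\})$, where $\top(R_i)$ is omitted at the root; 4. a row with the largest count in all the $T^i$; it returns this count and this row $t^*$ as a tuple of $R_i$, with an arbitrary value at attributes that occur in no other relation (if all $T^i$ are empty, it returns $0$ and an arbitrary tuple). Then the following holds. Every acyclic $Q$ has a tree recorded by a GYO decomposition (an eliminated ear hangs below a remaining hyperedge containing all its vertices that are shared with remaining hyperedges), and every such tree is a join tree. For every query $Q$, every join tree $\mathcal{T}$ of $Q$ and every database $\mathcal{D}$, LSAcyclicJoin returns $LS(Q,\mathcal{D})$ (in particular the maximum exists) and a most sensitive tuple $t^*$, i.e. $TSens(t^*) = LS(Q,\mathcal{D})$. Moreover, there is an absolute constant $c$ such that, if $m\ge 2$ and $n\ge 2$, the running time is at most $c\, m\, d\, n^{d} \log n$, where $d$ is the maximum degree of $\mathcal{T}$ (number of children, plus one for the parent at non-root nodes). Running time is the number of elementary steps, where reading, comparing, projecting or combining tuples, arithmetic on counts and operations on attribute sets have unit cost. -/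

import Mathlib

universe u v w

noncomputable section

namespace LSJoin

/-! ## Queries, tuples, bag semantics and sensitivity -/

/-- A full conjunctive query `R_1(𝔸_1), …, R_m(𝔸_m)` without self-joins, over attributes named by
`Fin k`: relation symbol `i` occurs exactly once and has the attribute set `Q i`. -/
abbrev Query (k m : ℕ) := Fin m → Finset (Fin k)

/-- Tuples over the attribute set `S`: the elements of `Σ^S = ∏_{a ∈ S} Σ^a`. -/
def Tuple {k : ℕ} (Dom : Fin k → Type u) (S : Finset (Fin k)) : Type u :=
  ∀ a : {a // a ∈ S}, Dom a

section Semantics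

variable {k m : ℕ} {Dom : Fin k → Type u}

/-- The restriction `t.S'` of a tuple to a smaller attribute set. -/
def Tuple.restrict {S S' : Finset (Fin k)} (h : S' ⊆ S) (t : Tuple Dom S) : Tuple Dom S' :=
  fun a => t ⟨a, h a.2⟩

/-- Two tuples put together (used when they agree on the common attributes). -/
def Tuple.glue {S S' : Finset (Fin k)} (t : Tuple Dom S) (t' : Tuple Dom S') :
    Tuple Dom (S ∪ S') :=
  fun a => if h : (a : Fin k) ∈ S then t ⟨a, h⟩
    else t' ⟨a, (Finset.mem_union.1 a.2).resolve_left h⟩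

/-- The tuple over `S'` that agrees with `t` where `t` is defined and takes an arbitrary (default)
value at the remaining attributes. -/
def Tuple.extrapolate [∀ a, Inhabited (Dom a)] {S : Finset (Fin k)} (t : Tuple Dom S)
    (S' : Finset (Fin k)) : Tuple Dom S' :=
  fun a => if h : (a : Fin k) ∈ S then t ⟨a, h⟩ else default

/-- Tuples are compared lexicographically. -/
instance [∀ a, LinearOrder (Dom a)] (S : Finset (Fin k)) : LinearOrder (Tuple Dom S) :=
  inferInstanceAs (LinearOrder (Lex (∀ a : {a // a ∈ S}, Dom a)))

/-- A database instance: every relation is a bag of tuples. -/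
abbrev Instance (Q : Query k m) (Dom : Fin k → Type u) := ∀ i, Multiset (Tuple Dom (Q i))

/-- The attributes `𝔸_D = ⋃ 𝔸_i` of the query. -/
def Query.attrs (Q : Query k m) : Finset (Fin k) := Finset.univ.biUnion Q

variable [∀ a, LinearOrder (Dom a)] {Q : Query k m}

/-- One row (counted with multiplicity) has been chosen from every relation; the chosen rows agree
on all common attributes. -/
def Compatible {D : Instance Q Dom} (f : ∀ i, (D i).ToType) : Prop :=
  ∀ (i j : Fin m) (a : Fin k) (hi : a ∈ Q i) (hj : a ∈ Q j), (f i).1 ⟨a, hi⟩ = (f j).1 ⟨a, hj⟩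

/-- The output row of a compatible choice of rows. -/
def outputRow {D : Instance Q Dom} (f : ∀ i, (D i).ToType) : Tuple Dom Q.attrs :=
  fun a =>
    let h : ∃ i, (a : Fin k) ∈ Q i := by simpa [Query.attrs] using a.2
    (f h.choose).1 ⟨a, h.choose_spec⟩

open Classical in
/-- The query result `Q(D)`: the natural join of all relations under bag semantics. -/
def answer (D : Instance Q Dom) : Multiset (Tuple Dom Q.attrs) :=
  (Finset.univ.filter fun f : ∀ i, (D i).ToType => Compatible f).val.map outputRow

/-- `D ∪ {t}`: one copy of `t` is added to relation `i`. -/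
def insertTuple (D : Instance Q Dom) (i : Fin m) (t : Tuple Dom (Q i)) : Instance Q Dom :=
  Function.update D i (t ::ₘ D i)

/-- `D \ {t}`: one copy of `t` is removed from relation `i` (nothing happens if there is none). -/
def deleteTuple (D : Instance Q Dom) (i : Fin m) (t : Tuple Dom (Q i)) : Instance Q Dom :=
  Function.update D i ((D i).erase t)

/-- The symmetric difference of two bags. -/
def bagSymmDiff {α : Type u} [DecidableEq α] (s t : Multiset α) : Multiset α := (s - t) ∪ (t - s)

/-- Upward tuple sensitivity. -/
def upSens (D : Instance Q Dom) (t : Σ i, Tuple Dom (Q i)) : ℕ :=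
  (bagSymmDiff (answer (insertTuple D t.1 t.2)) (answer D)).card

/-- Downward tuple sensitivity. -/
def downSens (D : Instance Q Dom) (t : Σ i, Tuple Dom (Q i)) : ℕ :=
  (bagSymmDiff (answer D) (answer (deleteTuple D t.1 t.2))).card

/-- Tuple sensitivity. -/
def tupleSens (D : Instance Q Dom) (t : Σ i, Tuple Dom (Q i)) : ℕ :=
  max (upSens D t) (downSens D t)

/-- `s` is the local sensitivity: the maximum of the tuple sensitivities over all tuples from the
(possibly infinite) domains of all relations. -/
def IsLocalSensitivity (D : Instance Q Dom) (s : ℕ) : Prop :=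
  IsGreatest (Set.range (tupleSens D)) s

end Semantics

/-! ## Rooted trees, GYO decomposition, join trees -/

/-- Finite rooted trees with labelled nodes. -/
inductive RTree (α : Type v) : Type v
  | node : α → List (RTree α) → RTree α

namespace RTree

variable {α : Type v}

/-- The label of the root. -/
def label : RTree α → α
  | node a _ => a

mutual
/-- The labels of all nodes. -/
def nodes : RTree α → List α
  | node a cs => a :: nodesList cs
/-- The labels of all nodes of a list of trees. -/
def nodesList : List (RTree α) → List α
  | [] => []
  | c :: cs => nodes c ++ nodesList cs
end

mutual
/-- All pairs (parent, child). -/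
def edges : RTree α → List (α × α)
  | node a cs => edgesList a cs
/-- All pairs (parent, child), for a list of trees below `a`. -/
def edgesList (a : α) : List (RTree α) → List (α × α)
  | [] => []
  | c :: cs => (a, c.label) :: (edges c ++ edgesList a cs)
end

/-- The underlying undirected graph. -/
def graph (T : RTree α) : SimpleGraph α :=
  SimpleGraph.fromRel fun a b => (a, b) ∈ T.edges

mutual
/-- The maximal degree within a tree whose root has `e` further edges. -/
def maxDegreeAux (e : ℕ) : RTree α → ℕ
  | node _ cs => max (cs.length + e) (maxDegreeList cs)
/-- The maximal degree of the nodes of a list of trees whose roots all have a parent. -/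
def maxDegreeList : List (RTree α) → ℕ
  | [] => 0
  | c :: cs => max (maxDegreeAux 1 c) (maxDegreeList cs)
end

/-- The maximal degree of the tree: the number of children, plus one (for the parent) at every node
other than the root. -/
def maxDegree (T : RTree α) : ℕ := maxDegreeAux 0 T

mutual
/-- Add a new leaf `i` as a child of the node `j`. -/
def attach [DecidableEq α] (j i : α) : RTree α → RTree α
  | node a cs => node a (if a = j then node i [] :: attachList j i cs else attachList j i cs)
/-- Add a new leaf `i` as a child of the node `j` in a list of trees. -/
def attachList [DecidableEq α] (j i : α) : List (RTree α) → List (RTree α)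
  | [] => []
  | c :: cs => attach j i c :: attachList j i cs
end

end RTree

section Acyclic

variable {k m : ℕ}

/-- Hyperedge `i` is an ear of the hypergraph with hyperedges `H`: each of its vertices belongs to
no other hyperedge, or those that do are all contained in one other hyperedge `j`. -/
def IsEar (Q : Query k m) (H : Finset (Fin m)) (i : Fin m) : Prop :=
  i ∈ H ∧ ((∀ a ∈ Q i, ∀ l ∈ H, l ≠ i → a ∉ Q l) ∨
    ∃ j ∈ H, j ≠ i ∧ ∀ a ∈ Q i, (∀ l ∈ H, l ≠ i → a ∉ Q l) ∨ a ∈ Q j)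

/-- Repeatedly removing ears can empty the hypergraph with hyperedges `H`. -/
inductive GYOReduces (Q : Query k m) : Finset (Fin m) → Prop
  | empty : GYOReduces Q ∅
  | ear {H : Finset (Fin m)} {i : Fin m} :
      IsEar Q H i → GYOReduces Q (H.erase i) → GYOReduces Q H

/-- Acyclic queries: the GYO decomposition ends with the empty hypergraph. -/
def Query.IsAcyclic (Q : Query k m) : Prop := GYOReduces Q Finset.univ

/-- `T` is a rooted tree recorded by a GYO decomposition of the hypergraph with hyperedges `H`: the
hyperedge that is eliminated last is the root, and whenever `i` is eliminated as an ear, it hangs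
below a remaining `j` that contains all vertices of `i` shared with remaining hyperedges. (If there
are none, as happens for disconnected hypergraphs, `i` may hang below any remaining `j`.) -/
inductive GYOTree (Q : Query k m) : Finset (Fin m) → RTree (Fin m) → Prop
  | last (i : Fin m) : GYOTree Q {i} (RTree.node i [])
  | ear {H : Finset (Fin m)} {T : RTree (Fin m)} {i j : Fin m} :
      GYOTree Q H T → i ∉ H → j ∈ H → (∀ a ∈ Q i, (∀ l ∈ H, a ∉ Q l) ∨ a ∈ Q j) →
      GYOTree Q (insert i H) (T.attach j i)

/-- `T` is a (rooted) join tree of `Q`: its nodes are the relations of `Q`, each once, and the common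
attributes of two relations `i`, `j` belong to all relations on the path from `i` to `j` (which is
unique, the graph being a tree). -/
structure IsJoinTree (Q : Query k m) (T : RTree (Fin m)) : Prop where
  nodes_perm : T.nodes.Perm (List.finRange m)
  path : ∀ i j : Fin m, ∃ p : T.graph.Walk i j, p.IsPath ∧ ∀ l ∈ p.support, Q i ∩ Q j ⊆ Q l

end Acyclic

/-! ## Computations with a step count

A step is one case of a recursive procedure together with a bounded number of basic operations:
reading, comparing, restricting or gluing tuples, adding or multiplying counts, operations on
attribute sets, building list cells or tree nodes. -/

/-- A value together with the number of steps that were spent on it. -/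
structure Timed (α : Type u) : Type u where
  val : α
  cost : ℕ

instance : Monad Timed.{u} where
  pure a := ⟨a, 0⟩
  bind x f := ⟨(f x.val).val, x.cost + (f x.val).cost⟩

/-- Spend one step. -/
def Timed.step {α : Type u} (c : Timed α) : Timed α := ⟨c.val, c.cost + 1⟩

/-- Spend `s` further steps. -/
def Timed.spend {α : Type u} (s : ℕ) (c : Timed α) : Timed α := ⟨c.val, c.cost + s⟩

open Timed

section Lists

variable {α : Type u} {β : Type u} {γ : Type u} {κ : Type w}

/-- `List.map`, one step per element. -/
def mapT {α : Type v} {β : Type u} (f : α → β) : List α → Timed (List β)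
  | [] => step (pure [])
  | a :: l => step do
      let l' ← mapT f l
      pure (f a :: l')

/-- `l₁.reverse ++ l₂`. -/
def revAppendT : List α → List α → Timed (List α)
  | [], l₂ => step (pure l₂)
  | a :: l₁, l₂ => step (revAppendT l₁ (a :: l₂))

/-- Deal the elements of a list alternately to two lists. -/
def splitT : List α → Timed (List α × List α)
  | [] => step (pure ([], []))
  | a :: l => step do
      let p ← splitT l
      pure (a :: p.2, p.1)

theorem splitT_length (l : List α) :
    (splitT l).val.1.length = (l.length + 1) / 2 ∧ (splitT l).val.2.length = l.length / 2 := by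
  induction l with
  | nil => simp [splitT, step, pure]
  | cons a l ih =>
    have h1 : (splitT (a :: l)).val = (a :: (splitT l).val.2, (splitT l).val.1) := rfl
    rw [h1]
    simp only [List.length_cons]
    omega

/-- Merge two lists that are sorted by `key`. -/
def mergeT [LinearOrder κ] (key : α → κ) : List α → List α → Timed (List α)
  | [], l₂ => step (pure l₂)
  | a :: l₁, [] => step (pure (a :: l₁))
  | a :: l₁, b :: l₂ => step (
      if key a ≤ key b then do
        let l ← mergeT key l₁ (b :: l₂)
        pure (a :: l)
      else do
        let l ← mergeT key (a :: l₁) l₂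
        pure (b :: l))
termination_by l₁ l₂ => l₁.length + l₂.length

/-- Merge sort by `key`. -/
def sortT [LinearOrder κ] (key : α → κ) : List α → Timed (List α)
  | [] => step (pure [])
  | [a] => step (pure [a])
  | a :: b :: l =>
      let p := splitT (a :: b :: l)
      step (spend p.cost do
        let l₁ ← sortT key p.val.1
        let l₂ ← sortT key p.val.2
        mergeT key l₁ l₂)
termination_by l => l.length
decreasing_by
  all_goals
    have h := splitT_length (a :: b :: l)
    simp only [List.length_cons] at h ⊢
    omega

/-- Put `f b` in front of `rest`, for all `b` in the initial block with key `c`. -/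
def emitBlock [LinearOrder κ] (key : β → κ) (c : κ) (f : β → γ) (rest : List γ) :
    List β → Timed (List γ)
  | [] => step (pure rest)
  | b :: l => step (
      if key b = c then do
        let out ← emitBlock key c f rest l
        pure (f b :: out)
      else pure rest)

/-- The merge phase of a sort-merge join of two lists sorted by their keys: all `f a b` for which
the keys of `a` and `b` coincide. -/
def mergeJoin [LinearOrder κ] (key₁ : α → κ) (key₂ : β → κ) (f : α → β → γ) :
    List α → List β → Timed (List γ)
  | [], _ => step (pure [])
  | _ :: _, [] => step (pure [])
  | a :: l₁, b :: l₂ => step (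
      if key₁ a < key₂ b then mergeJoin key₁ key₂ f l₁ (b :: l₂)
      else if key₂ b < key₁ a then mergeJoin key₁ key₂ f (a :: l₁) l₂
      else do
        let rest ← mergeJoin key₁ key₂ f l₁ (b :: l₂)
        emitBlock key₂ (key₁ a) (f a) rest (b :: l₂))
termination_by l₁ l₂ => l₁.length + l₂.length

/-- Collapse each block of consecutive rows with equal tuples, starting with the row `r`, to one
row; the counts are added. -/
def collapseFrom [LinearOrder α] (r : α × ℕ) : List (α × ℕ) → Timed (List (α × ℕ))
  | [] => step (pure [r])
  | s :: l => step (
      if s.1 = r.1 then collapseFrom (r.1, r.2 + s.2) l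
      else do
        let out ← collapseFrom s l
        pure (r :: out))

/-- Collapse each block of consecutive rows with equal tuples to one row, adding the counts. -/
def collapse [LinearOrder α] : List (α × ℕ) → Timed (List (α × ℕ))
  | [] => step (pure [])
  | r :: l => step (collapseFrom r l)

end Lists

/-! ## The algorithm -/

/-- A table with a multiplicity column `cnt`. -/
structure Table {k : ℕ} (Dom : Fin k → Type u) : Type u where
  schema : Finset (Fin k)
  rows : List (Tuple Dom schema × ℕ)

section Algorithm

variable {k m : ℕ} {Dom : Fin k → Type u} [∀ a, LinearOrder (Dom a)]

/-- Group by the attributes in `S` and add the counts, by sorting. -/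
def groupBy (S : Finset (Fin k)) (R : Table Dom) : Timed (Table Dom) := step do
  let keyed ← mapT (fun r : Tuple Dom R.schema × ℕ =>
    (r.1.restrict (Finset.inter_subset_right (s₁ := S)), r.2)) R.rows
  let sorted ← sortT (fun r : Tuple Dom (S ∩ R.schema) × ℕ => r.1) keyed
  let rows ← collapse sorted
  pure ⟨S ∩ R.schema, rows⟩

/-- The natural join of two tables, with the product of the counts, by sort-merge. -/
def join (R R' : Table Dom) : Timed (Table Dom) := step do
  let key : Tuple Dom R.schema × ℕ → Tuple Dom (R.schema ∩ R'.schema) :=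
    fun r => r.1.restrict Finset.inter_subset_left
  let key' : Tuple Dom R'.schema × ℕ → Tuple Dom (R.schema ∩ R'.schema) :=
    fun r => r.1.restrict Finset.inter_subset_right
  let l ← sortT key R.rows
  let l' ← sortT key' R'.rows
  let rows ← mergeJoin key key' (fun r r' => (r.1.glue r'.1, r.2 * r'.2)) l l'
  pure ⟨R.schema ∪ R'.schema, rows⟩

/-- Join a table with the tables of a list, one by one. -/
def joinFrom (R : Table Dom) : List (Table Dom) → Timed (Table Dom)
  | [] => step (pure R)
  | R' :: l => step do
      let J ← join R R'
      joinFrom J l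

/-- Join the tables of a list, one by one; the empty join has one row, the empty tuple. -/
def joinAll : List (Table Dom) → Timed (Table Dom)
  | [] => step (pure ⟨∅, [(fun a => absurd a.2 (Finset.notMem_empty _), 1)]⟩)
  | R :: l => step (joinFrom R l)

/-- A database as it is stored: every relation is a list of tuples, in any order and possibly with
repetitions. -/
abbrev Database (Q : Query k m) (Dom : Fin k → Type u) := ∀ i, List (Tuple Dom (Q i))

/-- The instance (a bag for each relation) that is stored in a database. -/
def Database.toInstance {Q : Query k m} (D : Database Q Dom) : Instance Q Dom :=
  fun i => (D i : Multiset (Tuple Dom (Q i)))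

/-- The total number `n` of tuples. -/
def Database.size {Q : Query k m} (D : Database Q Dom) : ℕ := ∑ i, (D i).length

/-- A relation with the additional column `cnt` that records the multiplicity of its tuples. -/
def countTable {Q : Query k m} (D : Database Q Dom) (i : Fin m) : Timed (Table Dom) := step do
  let rows ← mapT (fun t => (t, 1)) (D i)
  groupBy (Q i) ⟨Q i, rows⟩

/-- What is stored at a node of the join tree after the first pass: the relation's index, the
relation with counts, and its botjoin. -/
structure BotInfo (m : ℕ) (Dom : Fin k → Type u) : Type u where
  idx : Fin m
  rel : Table Dom
  bot : Table Dom

/-- What is stored at a node of the join tree after the second pass; the topjoin is absent at the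
root. -/
structure TopInfo (m : ℕ) (Dom : Fin k → Type u) extends BotInfo m Dom where
  top : Option (Table Dom)

mutual
/-- I) The botjoins in post-order: `⊥(R_i) = γ_{𝔸_i ∩ P} ⋈(R_i, {⊥(R_j) : R_j child of R_i})`,
where `P` is the attribute set of the parent (and of `R_i` itself, if `R_i` is the root). -/
def botPass {Q : Query k m} (D : Database Q Dom) (P : Finset (Fin k)) :
    RTree (Fin m) → Timed (RTree (BotInfo m Dom))
  | .node i cs => step do
      let R ← countTable D i
      let cs' ← botPassList D (Q i) cs
      let bots ← mapT (fun c => c.label.bot) cs'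
      let J ← joinFrom R bots
      let b ← groupBy (Q i ∩ P) J
      pure (.node ⟨i, R, b⟩ cs')
/-- The botjoins in a list of trees. -/
def botPassList {Q : Query k m} (D : Database Q Dom) (P : Finset (Fin k)) :
    List (RTree (Fin m)) → Timed (List (RTree (BotInfo m Dom)))
  | [] => step (pure [])
  | c :: cs => step do
      let c' ← botPass D P c
      let cs' ← botPassList D P cs
      pure (c' :: cs')
end

mutual
/-- II) The topjoins in pre-order, in a tree whose root has the topjoin `top`. -/
def topPass (Q : Query k m) (top : Option (Table Dom)) :
    RTree (BotInfo m Dom) → Timed (RTree (TopInfo m Dom))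
  | .node v cs => step do
      let cs' ← topPassList Q v top [] cs
      pure (.node ⟨v, top⟩ cs')
/-- The topjoins in the list of the remaining trees below the node `p`, where `left` are the
botjoins of the preceding children:
`⊤(R_i) = γ_{𝔸_i ∩ 𝔸_p} ⋈(R_p, ⊤(R_p), {⊥(R_j) : R_j sibling of R_i})`. -/
def topPassList (Q : Query k m) (p : BotInfo m Dom) (top : Option (Table Dom))
    (left : List (Table Dom)) :
    List (RTree (BotInfo m Dom)) → Timed (List (RTree (TopInfo m Dom)))
  | [] => step (pure [])
  | c :: cs => step do
      let right ← mapT (fun c' => c'.label.bot) cs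
      let siblings ← revAppendT left right
      let J ← joinFrom p.rel (top.toList ++ siblings)
      let t ← groupBy (Q c.label.idx ∩ Q p.idx) J
      let c' ← topPass Q (some t) c
      let cs' ← topPassList Q p top (c.label.bot :: left) cs
      pure (c' :: cs')
end

mutual
/-- III) The multiplicity tables `T^i = γ_{𝔸_i} ⋈(⊤(R_i), {⊥(R_j) : R_j child of R_i})`, put in front
of the list `acc`. -/
def multPass (Q : Query k m) (acc : List (Fin m × Table Dom)) :
    RTree (TopInfo m Dom) → Timed (List (Fin m × Table Dom))
  | .node v cs => step do
      let bots ← mapT (fun c => c.label.bot) cs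
      let J ← joinAll (v.top.toList ++ bots)
      let M ← groupBy (Q v.idx) J
      let acc' ← multPassList Q acc cs
      pure ((v.idx, M) :: acc')
/-- The multiplicity tables of a list of trees. -/
def multPassList (Q : Query k m) (acc : List (Fin m × Table Dom)) :
    List (RTree (TopInfo m Dom)) → Timed (List (Fin m × Table Dom))
  | [] => step (pure acc)
  | c :: cs => step do
      let acc' ← multPassList Q acc cs
      multPass Q acc' c
end

/-- The output: a count, and a tuple from the domain of one of the relations. -/
structure Output (Q : Query k m) (Dom : Fin k → Type u) : Type u where
  sens : ℕ
  tuple : Σ i, Tuple Dom (Q i)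

variable [∀ a, Inhabited (Dom a)]

/-- IV) The row with the largest count among `best` and the rows of `T^i`. Attributes that occur in
no other relation get an arbitrary value. -/
def bestRow {Q : Query k m} (i : Fin m) {S : Finset (Fin k)} (best : Output Q Dom) :
    List (Tuple Dom S × ℕ) → Timed (Output Q Dom)
  | [] => step (pure best)
  | r :: l => step (
      bestRow i (if best.sens < r.2 then ⟨r.2, ⟨i, r.1.extrapolate (Q i)⟩⟩ else best) l)

/-- The row with the largest count among `best` and the rows of a list of multiplicity tables. -/
def bestTable {Q : Query k m} (best : Output Q Dom) :
    List (Fin m × Table Dom) → Timed (Output Q Dom)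
  | [] => step (pure best)
  | p :: l => step do
      let best' ← bestRow p.1 best p.2.rows
      bestTable best' l

/-- The algorithm, on a join tree of the query and a database. If all multiplicity tables are
empty, it returns the count `0` and an arbitrary tuple. -/
def lsAcyclicJoin (Q : Query k m) (T : RTree (Fin m)) (D : Database Q Dom) :
    Timed (Output Q Dom) := step do
  let T₁ ← botPass D (Q T.label) T
  let T₂ ← topPass Q none T₁
  let tables ← multPass Q [] T₂
  bestTable ⟨0, ⟨T.label, fun _ => default⟩⟩ tables

end Algorithm

end LSJoin

end

/-! Every attribute occurs in some relation, so an output row consists of one tuple from each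
relation, and its multiplicity is the product of their multiplicities. Hence the tuple sensitivity
of `t`, a tuple of `R_i`, is the sum, over all extensions of `t` to the remaining attributes, of the
product of the multiplicities in the other relations. For such a sum, over the attributes outside
`S`, of a product over a set of relations, we speak of the message that these relations send to `S`.

In a join tree, the subtrees below `R_i` and the part of the tree above `R_i` share attributes with
each other only inside `𝔸_i`, so the message to `𝔸_i` from all other relations is the product of the
messages from these parts, each of which decomposes in the same way at its own node next to `R_i`.
The botjoins and topjoins are precisely the messages along the edges of the tree, and the
multiplicity table `T^i` is the message to `𝔸_i`.

For the running time, the tables that enter the join for a botjoin or topjoin are a relation and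
tables that have attributes of this relation only and at most one row for each tuple, so that the
number of rows never exceeds `n`. The multiplicity table of a node of degree at most `d` joins at
most `d` tables with at most `n` rows each, and sorting `n ^ d` rows costs the factor
`log (n ^ d) = d * log n`. -/

namespace LSJoin

namespace Timed

variable {α β : Type u}

@[simp] theorem val_pure (a : α) : (pure a : Timed α).val = a := rfl

@[simp] theorem cost_pure (a : α) : (pure a : Timed α).cost = 0 := rfl

@[simp] theorem val_bind (x : Timed α) (f : α → Timed β) : (x >>= f).val = (f x.val).val := rfl

@[simp] theorem cost_bind (x : Timed α) (f : α → Timed β) :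
    (x >>= f).cost = x.cost + (f x.val).cost := rfl

@[simp] theorem val_step (x : Timed α) : x.step.val = x.val := rfl

@[simp] theorem cost_step (x : Timed α) : x.step.cost = x.cost + 1 := rfl

@[simp] theorem cost_spend (s : ℕ) (x : Timed α) : (x.spend s).cost = x.cost + s := rfl

end Timed

/-! ### Sorting, merging and collapsing lists -/

section Lists

variable {α β γ : Type u} {κ : Type w}

@[simp] theorem mapT_val {α : Type v} {β : Type u} (f : α → β) (l : List α) :
    (mapT f l).val = l.map f := by
  induction l with
  | nil => rfl
  | cons a l ih => simp [mapT, ih]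

@[simp] theorem mapT_cost {α : Type v} {β : Type u} (f : α → β) (l : List α) :
    (mapT f l).cost = l.length + 1 := by
  induction l with
  | nil => rfl
  | cons a l ih => simp [mapT, ih]

@[simp] theorem revAppendT_val (l₁ l₂ : List α) :
    (revAppendT l₁ l₂).val = l₁.reverse ++ l₂ := by
  induction l₁ generalizing l₂ with
  | nil => rfl
  | cons a l ih => simp [revAppendT, ih]

@[simp] theorem revAppendT_cost (l₁ l₂ : List α) :
    (revAppendT l₁ l₂).cost = l₁.length + 1 := by
  induction l₁ generalizing l₂ with
  | nil => rfl
  | cons a l ih => simp [revAppendT, ih]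

@[simp] theorem splitT_cost (l : List α) : (splitT l).cost = l.length + 1 := by
  induction l with
  | nil => rfl
  | cons a l ih => simp [splitT, ih]

theorem splitT_perm (l : List α) : ((splitT l).val.1 ++ (splitT l).val.2).Perm l := by
  induction l with
  | nil => exact List.Perm.refl _
  | cons a l ih => exact (List.perm_append_comm.trans ih).cons a

variable [LinearOrder κ]

theorem le_key_of_mem_cons {key : β → κ} {c : κ} {b : β} {l : List β}
    (hl : (b :: l).Pairwise (key · ≤ key ·)) (hc : c ≤ key b) {x : β} (hx : x ∈ b :: l) :
    c ≤ key x := by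
  rcases List.mem_cons.1 hx with rfl | hx
  · exact hc
  · exact hc.trans (List.rel_of_pairwise_cons hl hx)

theorem mergeT_perm (key : α → κ) (l₁ l₂ : List α) :
    (mergeT key l₁ l₂).val.Perm (l₁ ++ l₂) := by
  induction l₁, l₂ using mergeT.induct with
  | case1 l₂ => simp [mergeT]
  | case2 a l₁ => simp [mergeT]
  | case3 a l₁ b l₂ ih ih' =>
    by_cases h : key a ≤ key b
    · simpa [mergeT, h] using ih
    · simp only [mergeT, h, if_false, Timed.val_step, Timed.val_bind, Timed.val_pure]
      exact (ih'.cons b).trans List.perm_middle.symm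

theorem mergeT_pairwise (key : α → κ) (l₁ l₂ : List α)
    (h₁ : l₁.Pairwise (key · ≤ key ·)) (h₂ : l₂.Pairwise (key · ≤ key ·)) :
    (mergeT key l₁ l₂).val.Pairwise (key · ≤ key ·) := by
  induction l₁, l₂ using mergeT.induct with
  | case1 l₂ => simpa [mergeT] using h₂
  | case2 a l₁ => simpa [mergeT] using h₁
  | case3 a l₁ b l₂ ih ih' =>
    by_cases h : key a ≤ key b
    · simp only [mergeT, h, if_true, Timed.val_step, Timed.val_bind, Timed.val_pure]
      refine List.pairwise_cons.2 ⟨fun x hx => ?_, ih h₁.of_cons h₂⟩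
      rcases List.mem_append.1 ((mergeT_perm key _ _).mem_iff.1 hx) with hx | hx
      · exact List.rel_of_pairwise_cons h₁ hx
      · exact le_key_of_mem_cons h₂ h hx
    · simp only [mergeT, h, if_false, Timed.val_step, Timed.val_bind, Timed.val_pure]
      refine List.pairwise_cons.2 ⟨fun x hx => ?_, ih' h₁ h₂.of_cons⟩
      rcases List.mem_append.1 ((mergeT_perm key _ _).mem_iff.1 hx) with hx | hx
      · exact le_key_of_mem_cons h₁ (not_le.1 h).le hx
      · exact List.rel_of_pairwise_cons h₂ hx

theorem mergeT_cost_le (key : α → κ) (l₁ l₂ : List α) :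
    (mergeT key l₁ l₂).cost ≤ l₁.length + l₂.length + 1 := by
  induction l₁, l₂ using mergeT.induct with
  | case1 l₂ => simp [mergeT]
  | case2 a l₁ => simp [mergeT]
  | case3 a l₁ b l₂ ih ih' =>
    by_cases h : key a ≤ key b <;>
      simp only [mergeT, h, if_true, if_false, Timed.cost_step, Timed.cost_bind, Timed.cost_pure,
        List.length_cons] at ih ih' ⊢ <;> omega

theorem sortT_perm (key : α → κ) (l : List α) : (sortT key l).val.Perm l := by
  induction l using sortT.induct with
  | case1 => simp [sortT]
  | case2 a => simp [sortT]
  | case3 a b l _ ih₁ ih₂ =>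
    rw [sortT]
    exact (mergeT_perm key _ _).trans ((ih₁.append ih₂).trans (splitT_perm _))

theorem sortT_pairwise (key : α → κ) (l : List α) :
    (sortT key l).val.Pairwise (key · ≤ key ·) := by
  induction l using sortT.induct with
  | case1 => simp [sortT]
  | case2 a => simp [sortT]
  | case3 a b l _ ih₁ ih₂ =>
    rw [sortT]
    exact mergeT_pairwise key _ _ ih₁ ih₂

@[simp] theorem sortT_length (key : α → κ) (l : List α) :
    (sortT key l).val.length = l.length := (sortT_perm key l).length_eq

theorem sortT_cost_le (key : α → κ) (l : List α) (e : ℕ) (h : l.length ≤ 2 ^ e) :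
    (sortT key l).cost ≤ 4 * l.length * e + l.length + 1 := by
  induction l using sortT.induct generalizing e with
  | case1 => simp [sortT]
  | case2 a => simp [sortT]
  | case3 a b l p ih₁ ih₂ =>
    obtain _ | e := e
    · simp at h
    obtain ⟨hlen₁, hlen₂⟩ := splitT_length (a :: b :: l)
    have hmerge := mergeT_cost_le key (sortT key p.val.1).val (sortT key p.val.2).val
    rw [sortT_length, sortT_length] at hmerge
    have hsplit : p.cost = (a :: b :: l).length + 1 := splitT_cost _
    have hsort₁ := ih₁ e (by rw [hlen₁]; omega)
    have hsort₂ := ih₂ e (by rw [hlen₂]; omega)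
    have hsum : (a :: b :: l).length = p.val.1.length + p.val.2.length := by
      simpa using (splitT_perm (a :: b :: l)).length_eq.symm
    have htwo : 2 ≤ (a :: b :: l).length := by simp
    rw [hsum] at hsplit htwo ⊢
    rw [sortT]
    simp only [Timed.cost_step, Timed.cost_spend, Timed.cost_bind]
    calc (sortT key p.val.1).cost + ((sortT key p.val.2).cost +
          (mergeT key (sortT key p.val.1).val (sortT key p.val.2).val).cost) + p.cost + 1
      _ ≤ 4 * p.val.1.length * e + 4 * p.val.2.length * e
          + 4 * (p.val.1.length + p.val.2.length) + (p.val.1.length + p.val.2.length) + 1 := by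
          omega
      _ = _ := by ring

theorem emitBlock_val (key : β → κ) (c : κ) (f : β → γ) (rest : List γ) (l : List β) :
    (emitBlock key c f rest l).val = (l.takeWhile fun b => key b = c).map f ++ rest := by
  induction l with
  | nil => rfl
  | cons b l ih => by_cases h : key b = c <;> simp [emitBlock, h, ih]

theorem emitBlock_cost_le (key : β → κ) (c : κ) (f : β → γ) (rest : List γ) (l : List β) :
    (emitBlock key c f rest l).cost + rest.length ≤
      (emitBlock key c f rest l).val.length + 1 := by
  induction l with
  | nil => simp [emitBlock, Nat.add_comm]
  | cons b l ih =>
    by_cases h : key b = c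
    · simp only [emitBlock, h, if_true, Timed.cost_step, Timed.cost_bind, Timed.cost_pure,
        Timed.val_step, Timed.val_bind, Timed.val_pure, List.length_cons]
      omega
    · simp [emitBlock, h, Nat.add_comm]

theorem filter_key_eq_nil {key : β → κ} {c : κ} {l : List β} (h : ∀ b ∈ l, c < key b) :
    (l.filter fun b => key b = c) = [] :=
  List.filter_eq_nil_iff.2 fun b hb => by simpa using (h b hb).ne'

theorem takeWhile_key_eq_filter {key : β → κ} {c : κ} {l : List β}
    (h : l.Pairwise (key · ≤ key ·)) (hc : ∀ b ∈ l, c ≤ key b) :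
    (l.takeWhile fun b => key b = c) = l.filter fun b => key b = c := by
  induction l with
  | nil => rfl
  | cons b l ih =>
    by_cases hb : key b = c
    · simp [hb, ih h.of_cons fun x hx => hc x (List.mem_cons_of_mem _ hx)]
    · have hlt : c < key b := lt_of_le_of_ne (hc b List.mem_cons_self) (Ne.symm hb)
      rw [List.takeWhile_cons_of_neg (by simpa using hb),
        filter_key_eq_nil fun x hx => hlt.trans_le (le_key_of_mem_cons h le_rfl hx)]

theorem mergeJoin_perm (key₁ : α → κ) (key₂ : β → κ) (f : α → β → γ) (l₁ : List α) (l₂ : List β)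
    (h₁ : l₁.Pairwise (key₁ · ≤ key₁ ·)) (h₂ : l₂.Pairwise (key₂ · ≤ key₂ ·)) :
    ((mergeJoin key₁ key₂ f l₁ l₂).val).Perm
      (l₁.flatMap fun a => (l₂.filter fun b => key₂ b = key₁ a).map (f a)) := by
  induction l₁, l₂ using mergeJoin.induct with
  | case1 l₂ => simp [mergeJoin]
  | case2 a l₁ => simp [mergeJoin]
  | case3 a l₁ b l₂ ih ih' =>
    rcases lt_trichotomy (key₁ a) (key₂ b) with h | h | h
    · rw [mergeJoin, if_pos h, List.flatMap_cons,
        filter_key_eq_nil fun x hx => h.trans_le (le_key_of_mem_cons h₂ le_rfl hx)]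
      exact ih h₁.of_cons h₂
    · rw [mergeJoin, if_neg h.not_lt, if_neg h.not_gt]
      simp only [Timed.val_step, Timed.val_bind, emitBlock_val, List.flatMap_cons]
      rw [takeWhile_key_eq_filter h₂ fun x hx => le_key_of_mem_cons h₂ h.le hx]
      exact (ih h₁.of_cons h₂).append_left _
    · rw [mergeJoin, if_neg h.not_gt, if_pos h]
      refine (ih' h₁ h₂.of_cons).trans (.of_eq (List.flatMap_congr fun x hx => ?_))
      have hlt : key₂ b < key₁ x := h.trans_le (le_key_of_mem_cons h₁ le_rfl hx)
      rw [List.filter_cons_of_neg (by simpa using hlt.ne)]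

theorem mergeJoin_cost_le (key₁ : α → κ) (key₂ : β → κ) (f : α → β → γ)
    (l₁ : List α) (l₂ : List β) :
    (mergeJoin key₁ key₂ f l₁ l₂).cost ≤
      2 * l₁.length + l₂.length + 1 + (mergeJoin key₁ key₂ f l₁ l₂).val.length := by
  induction l₁, l₂ using mergeJoin.induct with
  | case1 l₂ => simp [mergeJoin]
  | case2 a l₁ => simp [mergeJoin]
  | case3 a l₁ b l₂ ih ih' =>
    rw [mergeJoin]
    have hemit := emitBlock_cost_le key₂ (key₁ a) (f a)
      (mergeJoin key₁ key₂ f l₁ (b :: l₂)).val (b :: l₂)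
    split_ifs <;> simp only [Timed.cost_step, Timed.val_step, Timed.cost_bind, Timed.val_bind,
      List.length_cons] at ih ih' ⊢ <;> omega

end Lists

/-- The total count of the rows that satisfy `p`, in a list of rows with counts. -/
def totalCount {α : Type*} (p : α → Prop) [DecidablePred p] (l : List (α × ℕ)) : ℕ :=
  (l.map fun s => if p s.1 then s.2 else 0).sum

section TotalCount

variable {α : Type*} (p : α → Prop) [DecidablePred p]

@[simp] theorem totalCount_nil : totalCount p [] = 0 := rfl

@[simp] theorem totalCount_cons (r : α × ℕ) (l : List (α × ℕ)) :
    totalCount p (r :: l) = (if p r.1 then r.2 else 0) + totalCount p l := rfl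

theorem totalCount_append (l l' : List (α × ℕ)) :
    totalCount p (l ++ l') = totalCount p l + totalCount p l' := by
  simp [totalCount]

variable {p}

theorem totalCount_eq_of_perm {l l' : List (α × ℕ)} (h : l.Perm l') :
    totalCount p l = totalCount p l' := (h.map _).sum_eq

theorem totalCount_eq_zero {l : List (α × ℕ)} (h : ∀ r ∈ l, ¬ p r.1) : totalCount p l = 0 := by
  induction l with
  | nil => rfl
  | cons r l ih =>
    rw [totalCount_cons, if_neg (h r List.mem_cons_self),
      ih fun s hs => h s (List.mem_cons_of_mem _ hs)]

theorem totalCount_eq_of_mem [DecidableEq α] {l : List (α × ℕ)} (hl : (l.map Prod.fst).Nodup)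
    {r : α × ℕ} (hr : r ∈ l) : totalCount (· = r.1) l = r.2 := by
  induction l with
  | nil => simp at hr
  | cons s l ih =>
    obtain ⟨hs, hl⟩ := List.nodup_cons.1 hl
    rw [totalCount_cons]
    rcases List.mem_cons.1 hr with rfl | hr
    · rw [if_pos rfl, totalCount_eq_zero fun x hx (hxr : x.1 = r.1) =>
        hs (List.mem_map.2 ⟨x, hx, hxr⟩), add_zero]
    · rw [if_neg fun hsr : s.1 = r.1 => hs (List.mem_map.2 ⟨r, hr, hsr.symm⟩), ih hl hr, zero_add]

end TotalCount

section Collapse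

variable {α : Type u} [LinearOrder α]

theorem totalCount_collapseFrom (p : α → Prop) [DecidablePred p] (r : α × ℕ)
    (l : List (α × ℕ)) : totalCount p (collapseFrom r l).val = totalCount p (r :: l) := by
  induction l generalizing r with
  | nil => rfl
  | cons s l ih =>
    by_cases h : s.1 = r.1
    · simp only [collapseFrom, h, if_true, Timed.val_step, ih, totalCount_cons]
      split_ifs <;> omega
    · simp only [collapseFrom, h, if_false, Timed.val_step, Timed.val_bind, Timed.val_pure, ih,
        totalCount_cons]

theorem totalCount_collapse (p : α → Prop) [DecidablePred p] (l : List (α × ℕ)) :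
    totalCount p (collapse l).val = totalCount p l := by
  cases l with
  | nil => rfl
  | cons r l => exact totalCount_collapseFrom p r l

theorem exists_mem_of_mem_collapseFrom {r : α × ℕ} {l : List (α × ℕ)} {s : α × ℕ}
    (hs : s ∈ (collapseFrom r l).val) : ∃ s' ∈ r :: l, s'.1 = s.1 := by
  induction l generalizing r with
  | nil => exact ⟨r, by simp, by simp_all [collapseFrom]⟩
  | cons q l ih =>
    by_cases h : q.1 = r.1
    · simp only [collapseFrom, h, if_true, Timed.val_step] at hs
      obtain ⟨s', h', e⟩ := ih hs
      rcases List.mem_cons.1 h' with rfl | h'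
      · exact ⟨r, by simp, e⟩
      · exact ⟨s', by simp [h'], e⟩
    · simp only [collapseFrom, h, if_false, Timed.val_step, Timed.val_bind, Timed.val_pure,
        List.mem_cons] at hs
      rcases hs with rfl | hs
      · exact ⟨s, by simp, rfl⟩
      · obtain ⟨s', h', e⟩ := ih hs
        exact ⟨s', List.mem_cons_of_mem _ h', e⟩

theorem exists_mem_of_mem_collapse {l : List (α × ℕ)} {s : α × ℕ}
    (hs : s ∈ (collapse l).val) : ∃ s' ∈ l, s'.1 = s.1 := by
  cases l with
  | nil => simp [collapse] at hs
  | cons r l => exact exists_mem_of_mem_collapseFrom hs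

theorem collapseFrom_nodup {r : α × ℕ} {l : List (α × ℕ)}
    (h : (r :: l).Pairwise (·.1 ≤ ·.1)) : ((collapseFrom r l).val.map Prod.fst).Nodup := by
  induction l generalizing r with
  | nil => simp [collapseFrom]
  | cons q l ih =>
    have hrq : r.1 ≤ q.1 := List.rel_of_pairwise_cons h List.mem_cons_self
    by_cases hq : q.1 = r.1
    · simp only [collapseFrom, hq, if_true, Timed.val_step]
      exact ih (List.pairwise_cons.2
        ⟨fun x hx => hq ▸ List.rel_of_pairwise_cons h.of_cons hx, h.of_cons.of_cons⟩)
    · simp only [collapseFrom, hq, if_false, Timed.val_step, Timed.val_bind, Timed.val_pure,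
        List.map_cons, List.nodup_cons]
      refine ⟨fun hr => ?_, ih h.of_cons⟩
      obtain ⟨s, hs, hsr⟩ := List.mem_map.1 hr
      obtain ⟨s', hs', hss'⟩ := exists_mem_of_mem_collapseFrom hs
      have hqs : q.1 ≤ s'.1 := le_key_of_mem_cons h.of_cons le_rfl hs'
      exact hq (le_antisymm (hqs.trans (hss'.trans hsr).le) hrq)

theorem collapse_nodup {l : List (α × ℕ)} (h : l.Pairwise (·.1 ≤ ·.1)) :
    ((collapse l).val.map Prod.fst).Nodup := by
  cases l with
  | nil => simp [collapse]
  | cons r l => exact collapseFrom_nodup h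

theorem collapseFrom_length_le (r : α × ℕ) (l : List (α × ℕ)) :
    (collapseFrom r l).val.length ≤ l.length + 1 := by
  induction l generalizing r with
  | nil => simp [collapseFrom]
  | cons q l ih =>
    by_cases hq : q.1 = r.1
    · simp only [collapseFrom, hq, if_true, Timed.val_step, List.length_cons]
      exact (ih _).trans (Nat.le_succ _)
    · simp only [collapseFrom, hq, if_false, Timed.val_step, Timed.val_bind, Timed.val_pure,
        List.length_cons]
      exact Nat.succ_le_succ (ih _)

theorem collapse_length_le (l : List (α × ℕ)) : (collapse l).val.length ≤ l.length := by
  cases l with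
  | nil => simp [collapse]
  | cons r l => exact collapseFrom_length_le r l

@[simp] theorem collapseFrom_cost (r : α × ℕ) (l : List (α × ℕ)) :
    (collapseFrom r l).cost = l.length + 1 := by
  induction l generalizing r with
  | nil => simp [collapseFrom]
  | cons q l ih => by_cases hq : q.1 = r.1 <;> simp [collapseFrom, hq, ih]

@[simp] theorem collapse_cost (l : List (α × ℕ)) : (collapse l).cost = l.length + 1 := by
  cases l <;> simp [collapse]

end Collapse

/-! ### Marginals and messages -/

section Marginals

variable {ι : Type*} [DecidableEq ι] {π : ι → Type*} {M : Type*} [CommSemiring M]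

/-- The marginal of `F`: the sum of `F` over all ways to overwrite an assignment on `A` by values
in `V`. -/
def marg (V : ∀ a, Finset (π a)) (A : Finset ι) (F : (∀ a, π a) → M) (σ : ∀ a, π a) : M :=
  ∑ y ∈ Fintype.piFinset fun a : A => V a, F (Function.updateFinset σ A y)

variable {V : ∀ a, Finset (π a)} {A A' S S' : Finset ι} {F F' G : (∀ a, π a) → M}

@[simp] theorem marg_empty : marg V ∅ F = F := by
  funext σ
  simp [marg]

theorem marg_dependsOn (hF : DependsOn F S) : DependsOn (marg V A F) (S \ A : Set ι) :=
  fun _ _ h => Finset.sum_congr rfl fun y _ => hF.updateFinset y h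

theorem marg_union (hA : Disjoint A A') (F : (∀ a, π a) → M) :
    marg V (A ∪ A') F = marg V A (marg V A' F) := by
  funext σ
  simp only [marg, Function.updateFinset_updateFinset hA]
  rw [← Finset.sum_product']
  refine (Finset.sum_equiv (Equiv.piFinsetUnion π hA) (fun y => ?_) fun y _ => rfl).symm
  rw [Finset.mem_product, Fintype.mem_piFinset, Fintype.mem_piFinset, Fintype.mem_piFinset]
  constructor
  · rintro ⟨h, h'⟩ ⟨a, ha⟩
    rcases Finset.mem_union.1 ha with haA | haA
    · simpa [Equiv.piFinsetUnion_left π hA haA ha] using h ⟨a, haA⟩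
    · simpa [Equiv.piFinsetUnion_right π hA haA ha] using h' ⟨a, haA⟩
  · refine fun h => ⟨fun a => ?_, fun a => ?_⟩
    · simpa [Equiv.piFinsetUnion_left π hA a.2] using h ⟨a, Finset.mem_union_left _ a.2⟩
    · simpa [Equiv.piFinsetUnion_right π hA a.2] using h ⟨a, Finset.mem_union_right _ a.2⟩

theorem marg_mul (hG : DependsOn G S) (hSA : Disjoint S A) (F : (∀ a, π a) → M) :
    marg V A (G * F) = G * marg V A F := by
  funext σ
  rw [Pi.mul_apply, marg, marg, Finset.mul_sum]
  refine Finset.sum_congr rfl fun y _ => ?_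
  rw [Pi.mul_apply, hG fun a ha => dif_neg (Finset.disjoint_left.1 hSA ha)]

theorem marg_mul_marg (hF : DependsOn F S) (hF' : DependsOn F' S') (h : Disjoint S A')
    (h' : Disjoint S' A) (hA : Disjoint A A') :
    marg V A F * marg V A' F' = marg V (A ∪ A') (F * F') := by
  rw [marg_union hA, marg_mul hF h, mul_comm F, mul_comm]
  refine (marg_mul (S := S' \ A') ?_ (h'.mono_left Finset.sdiff_subset) F).symm
  exact Finset.coe_sdiff S' A' ▸ marg_dependsOn hF'

variable {J : Type*} {Q : J → Finset ι} {w : J → (∀ a, π a) → M}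

theorem prod_dependsOn (hw : ∀ j, DependsOn (w j) (Q j)) (X : Finset J) :
    DependsOn (∏ j ∈ X, w j) (X.biUnion Q) := by
  intro σ τ h
  rw [Finset.prod_apply, Finset.prod_apply]
  exact Finset.prod_congr rfl fun j hj => hw j fun a ha =>
    h a (Finset.mem_biUnion.2 ⟨j, hj, ha⟩)

/-- The message that the factors `w j`, `j ∈ X`, send to the variables in `S`: their product, with
all other variables summed out. Botjoins, topjoins and multiplicity tables all hold messages. -/
def message (V : ∀ a, Finset (π a)) (Q : J → Finset ι) (w : J → (∀ a, π a) → M) (S : Finset ι)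
    (X : Finset J) : (∀ a, π a) → M :=
  marg V (X.biUnion Q \ S) (∏ j ∈ X, w j)

@[simp] theorem message_empty (S : Finset ι) : message V Q w S ∅ = 1 := by
  simp [message]

variable [DecidableEq J] {X Y : Finset J}

theorem message_mul_message (hw : ∀ j, DependsOn (w j) (Q j)) (hXY : Disjoint X Y)
    (h : ∀ x ∈ X, ∀ y ∈ Y, Q x ∩ Q y ⊆ S) :
    message V Q w S X * message V Q w S Y = message V Q w S (X ∪ Y) := by
  have hS : ∀ a ∈ X.biUnion Q, a ∈ Y.biUnion Q → a ∈ S := by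
    intro a haX haY
    obtain ⟨x, hx, hax⟩ := Finset.mem_biUnion.1 haX
    obtain ⟨y, hy, hay⟩ := Finset.mem_biUnion.1 haY
    exact h x hx y hy (Finset.mem_inter.2 ⟨hax, hay⟩)
  unfold message
  rw [marg_mul_marg (prod_dependsOn hw X) (prod_dependsOn hw Y), Finset.prod_union hXY,
    ← Finset.union_sdiff_distrib, Finset.union_biUnion]
  all_goals
    simp only [Finset.disjoint_left, Finset.mem_sdiff]
    tauto

theorem marg_mul_message (hw : ∀ j, DependsOn (w j) (Q j)) {i : J} (hi : i ∉ X)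
    (h : ∀ x ∈ X, Q x ∩ S ⊆ Q i) :
    marg V (Q i \ S) (w i * message V Q w (Q i) X) = message V Q w S (insert i X) := by
  have hvars : Q i \ S ∪ X.biUnion Q \ Q i = (insert i X).biUnion Q \ S := by
    ext a
    simp only [Finset.mem_union, Finset.mem_sdiff, Finset.mem_biUnion, Finset.mem_insert,
      exists_eq_or_imp]
    have hX : ∀ x ∈ X, a ∈ Q x → a ∈ S → a ∈ Q i := fun x hx hax haS =>
      h x hx (Finset.mem_inter.2 ⟨hax, haS⟩)
    tauto
  unfold message
  rw [← marg_mul (hw i) Finset.disjoint_sdiff, ← marg_union, Finset.prod_insert hi, hvars]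
  exact Finset.disjoint_of_subset_left Finset.sdiff_subset Finset.disjoint_sdiff

end Marginals

/-! ### Tables -/

section Tables

variable {k m : ℕ} {Dom : Fin k → Type u} {S S' : Finset (Fin k)} {σ : ∀ a, Dom a}

/-- The tuple over `S` given by a total assignment of values to the attributes. Total assignments
let tables with different schemas be regarded as functions on one set. -/
def Tuple.ofAssignment (S : Finset (Fin k)) (σ : ∀ a, Dom a) : Tuple Dom S := S.restrict σ

theorem Tuple.eq_ofAssignment_iff {t : Tuple Dom S} :
    t = ofAssignment S σ ↔ ∀ a (h : a ∈ S), t ⟨a, h⟩ = σ a :=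
  ⟨fun h a ha => by rw [h]; rfl, fun h => funext fun a => h a a.2⟩

theorem Tuple.dependsOn_ofAssignment :
    DependsOn (ofAssignment S : (∀ a, Dom a) → Tuple Dom S) S :=
  fun _ _ h => funext fun a => h a a.2

theorem Tuple.restrict_eq_and_glue_eq_iff (t : Tuple Dom S) (t' : Tuple Dom S') :
    (t'.restrict (Finset.inter_subset_right (s₁ := S)) =
        t.restrict (Finset.inter_subset_left (s₂ := S')) ∧
      t.glue t' = ofAssignment (S ∪ S') σ) ↔ t = ofAssignment S σ ∧ t' = ofAssignment S' σ := by
  simp only [eq_ofAssignment_iff]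
  constructor
  · rintro ⟨h, hg⟩
    have ht : ∀ a (ha : a ∈ S), t ⟨a, ha⟩ = σ a := fun a ha => by
      simpa [glue, ha] using hg a (Finset.mem_union_left _ ha)
    refine ⟨ht, fun a ha => ?_⟩
    by_cases hS : a ∈ S
    · exact (congrFun h ⟨a, Finset.mem_inter.2 ⟨hS, ha⟩⟩).trans (ht a hS)
    · simpa [glue, hS] using hg a (Finset.mem_union_right _ ha)
  · rintro ⟨h, h'⟩
    refine ⟨funext fun a => ?_, fun a ha => ?_⟩
    · simp only [restrict, h, h']
    · by_cases hS : a ∈ S <;> simp [glue, hS, h, h']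

theorem Tuple.eq_ofAssignment_updateFinset_iff (t : Tuple Dom S')
    (y : ∀ a : {a // a ∈ S' \ S}, Dom a) :
    t = ofAssignment S' (Function.updateFinset σ (S' \ S) y) ↔
      t.restrict (Finset.inter_subset_right (s₁ := S)) = ofAssignment (S ∩ S') σ ∧
        t.restrict Finset.sdiff_subset = y := by
  rw [eq_ofAssignment_iff, eq_ofAssignment_iff]
  constructor
  · intro h
    refine ⟨fun a ha => ?_, funext fun a => ?_⟩
    · rw [restrict, h]
      exact dif_neg fun ha' => (Finset.mem_sdiff.1 ha').2 (Finset.mem_inter.1 ha).1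
    · rw [restrict, h]
      exact dif_pos a.2
  · rintro ⟨h, rfl⟩ a ha
    by_cases haS : a ∈ S
    · simpa [Function.updateFinset, restrict, haS] using h a (Finset.mem_inter.2 ⟨haS, ha⟩)
    · simp [Function.updateFinset, restrict, haS, ha]

theorem Tuple.glue_mem {V : ∀ a, Finset (Dom a)} {t : Tuple Dom S} {t' : Tuple Dom S'}
    (h : ∀ a : {a // a ∈ S}, t a ∈ V a) (h' : ∀ a : {a // a ∈ S'}, t' a ∈ V a)
    (a : {a // a ∈ S ∪ S'}) : t.glue t' a ∈ V a := by
  unfold glue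
  split_ifs with ha
  · exact h ⟨a, ha⟩
  · exact h' ⟨a, (Finset.mem_union.1 a.2).resolve_left ha⟩

/-- All values in the rows of the table belong to `V`: then sums over `V` see all the rows, even
when the domains are infinite. -/
def Table.Within (V : ∀ a, Finset (Dom a)) (R : Table Dom) : Prop :=
  ∀ r ∈ R.rows, ∀ a : {a // a ∈ R.schema}, r.1 a ∈ V a

variable {V : ∀ a, Finset (Dom a)} [∀ a, LinearOrder (Dom a)]

/-- A table as a function on assignments: the total count of the rows that agree with `σ`. -/
noncomputable def Table.weight (R : Table Dom) (σ : ∀ a, Dom a) : ℕ :=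
  totalCount (· = Tuple.ofAssignment R.schema σ) R.rows

theorem Table.weight_eq_of_mem {R : Table Dom} (hR : (R.rows.map Prod.fst).Nodup)
    {r : Tuple Dom R.schema × ℕ} (hr : r ∈ R.rows) (h : r.1 = Tuple.ofAssignment R.schema σ) :
    R.weight σ = r.2 := by
  unfold weight
  rw [← h]
  exact totalCount_eq_of_mem hR hr

theorem Table.exists_mem_of_weight_ne_zero {R : Table Dom} (h : R.weight σ ≠ 0) :
    ∃ r ∈ R.rows, r.1 = Tuple.ofAssignment R.schema σ := by
  contrapose! h
  exact totalCount_eq_zero h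

/-- The rows that arise by gluing `r` to a row of `l` that agrees with it. -/
noncomputable def joinRow (r : Tuple Dom S × ℕ) (l : List (Tuple Dom S' × ℕ)) :
    List (Tuple Dom (S ∪ S') × ℕ) :=
  (l.filter fun r' => r'.1.restrict (Finset.inter_subset_right (s₁ := S)) =
    r.1.restrict (Finset.inter_subset_left (s₂ := S'))).map fun r' => (r.1.glue r'.1, r.2 * r'.2)

theorem totalCount_joinRow (r : Tuple Dom S × ℕ) (l : List (Tuple Dom S' × ℕ)) :
    totalCount (· = Tuple.ofAssignment (S ∪ S') σ) (joinRow r l) =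
      (if r.1 = Tuple.ofAssignment S σ then r.2 else 0) *
        totalCount (· = Tuple.ofAssignment S' σ) l := by
  induction l with
  | nil => rfl
  | cons r' l ih =>
    have hglue := Tuple.restrict_eq_and_glue_eq_iff (σ := σ) r.1 r'.1
    rw [totalCount_cons, mul_add, ← ih, ite_zero_mul_ite_zero]
    simp only [joinRow, List.filter_cons, decide_eq_true_eq]
    split_ifs with hres hr hr
    · rw [List.map_cons, totalCount_cons, if_pos (hglue.2 hr).2]
    · rw [List.map_cons, totalCount_cons, if_neg fun h => hr (hglue.1 ⟨hres, h⟩)]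
    · exact absurd (hglue.2 hr).1 hres
    · rw [zero_add]

theorem totalCount_flatMap_joinRow (l : List (Tuple Dom S × ℕ)) (l' : List (Tuple Dom S' × ℕ)) :
    totalCount (· = Tuple.ofAssignment (S ∪ S') σ) (l.flatMap fun r => joinRow r l') =
      totalCount (· = Tuple.ofAssignment S σ) l * totalCount (· = Tuple.ofAssignment S' σ) l' := by
  induction l with
  | nil => exact (zero_mul _).symm
  | cons r l ih =>
    rw [List.flatMap_cons, totalCount_append, totalCount_cons, add_mul, ← ih, totalCount_joinRow]

theorem length_joinRow_le (r : Tuple Dom S × ℕ) (l : List (Tuple Dom S' × ℕ)) :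
    (joinRow r l).length ≤ l.length := by
  rw [joinRow, List.length_map]
  exact List.length_filter_le _ _

theorem length_joinRow_le_one (hS : S' ⊆ S) (r : Tuple Dom S × ℕ) {l : List (Tuple Dom S' × ℕ)}
    (hl : (l.map Prod.fst).Nodup) : (joinRow r l).length ≤ 1 := by
  have hfst : ∀ t ∈ (l.filter fun r' => r'.1.restrict (Finset.inter_subset_right (s₁ := S)) =
      r.1.restrict (Finset.inter_subset_left (s₂ := S'))).map Prod.fst,
      t = r.1.restrict hS := by
    intro t ht
    obtain ⟨r', hr', rfl⟩ := List.mem_map.1 ht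
    have hres := of_decide_eq_true (List.mem_filter.1 hr').2
    exact funext fun a => congrFun hres ⟨a, Finset.mem_inter.2 ⟨hS a.2, a.2⟩⟩
  have hnodup := hl.sublist ((List.filter_sublist (p := fun r' : Tuple Dom S' × ℕ =>
    r'.1.restrict (Finset.inter_subset_right (s₁ := S)) =
      r.1.restrict (Finset.inter_subset_left (s₂ := S')))).map Prod.fst)
  rw [List.eq_replicate_of_mem hfst, List.nodup_replicate, List.length_map] at hnodup
  rwa [joinRow, List.length_map]

theorem join_rows_perm (R R' : Table Dom) :
    (join R R').val.rows.Perm (R.rows.flatMap fun r => joinRow r R'.rows) := by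
  refine (mergeJoin_perm _ _ _ _ _ (sortT_pairwise _ _) (sortT_pairwise _ _)).trans ?_
  refine (List.Perm.flatMap_right _ (sortT_perm _ _)).trans ?_
  exact List.Perm.flatMap_left _ fun a _ => ((sortT_perm _ _).filter _).map _

theorem join_weight (R R' : Table Dom) : (join R R').val.weight = R.weight * R'.weight :=
  funext fun _ => (totalCount_eq_of_perm (join_rows_perm R R')).trans
    (totalCount_flatMap_joinRow R.rows R'.rows)

theorem join_within {R R' : Table Dom} (h : R.Within V) (h' : R'.Within V) :
    (join R R').val.Within V := by
  intro r hr a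
  obtain ⟨s, hs, hr⟩ := List.mem_flatMap.1 ((join_rows_perm R R').mem_iff.1 hr)
  obtain ⟨s', hs', rfl⟩ := List.mem_map.1 hr
  exact Tuple.glue_mem (h s hs) (h' s' (List.mem_of_mem_filter hs')) a

theorem length_flatMap_le_mul {α β : Type*} {l : List α} {f : α → List β} {N : ℕ}
    (h : ∀ a ∈ l, (f a).length ≤ N) : (l.flatMap f).length ≤ l.length * N := by
  rw [List.length_flatMap, ← smul_eq_mul, ← List.length_map (fun a => (f a).length)]
  exact List.sum_le_card_nsmul _ _ (List.forall_mem_map.2 h)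

theorem join_length_le_mul (R R' : Table Dom) :
    (join R R').val.rows.length ≤ R.rows.length * R'.rows.length :=
  (join_rows_perm R R').length_eq.trans_le
    (length_flatMap_le_mul fun r _ => length_joinRow_le r R'.rows)

theorem join_length_le {R R' : Table Dom} (hR' : (R'.rows.map Prod.fst).Nodup)
    (hs : R'.schema ⊆ R.schema) : (join R R').val.rows.length ≤ R.rows.length :=
  ((join_rows_perm R R').length_eq.trans_le
    (length_flatMap_le_mul fun r _ => length_joinRow_le_one hs r hR')).trans_eq (mul_one _)

theorem join_cost_le (R R' : Table Dom) {e e' : ℕ} (h : R.rows.length ≤ 2 ^ e)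
    (h' : R'.rows.length ≤ 2 ^ e') :
    (join R R').cost ≤ 4 * R.rows.length * e + 3 * R.rows.length + 4 * R'.rows.length * e' +
      2 * R'.rows.length + (join R R').val.rows.length + 4 := by
  let key (r : Tuple Dom R.schema × ℕ) : Tuple Dom (R.schema ∩ R'.schema) :=
    r.1.restrict Finset.inter_subset_left
  let key' (r : Tuple Dom R'.schema × ℕ) : Tuple Dom (R.schema ∩ R'.schema) :=
    r.1.restrict Finset.inter_subset_right
  have hsort := sortT_cost_le key R.rows e h
  have hsort' := sortT_cost_le key' R'.rows e' h'
  have hmerge := mergeJoin_cost_le key key' (fun r r' => (r.1.glue r'.1, r.2 * r'.2))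
    (sortT key R.rows).val (sortT key' R'.rows).val
  simp only [key, key', sortT_length] at hsort hsort' hmerge
  simp only [join, Timed.cost_step, Timed.val_step, Timed.cost_bind, Timed.val_bind,
    Timed.cost_pure, Timed.val_pure]
  omega

theorem groupBy_nodup (S : Finset (Fin k)) (R : Table Dom) :
    ((groupBy S R).val.rows.map Prod.fst).Nodup :=
  collapse_nodup (sortT_pairwise _ _)

theorem groupBy_length_le (S : Finset (Fin k)) (R : Table Dom) :
    (groupBy S R).val.rows.length ≤ R.rows.length :=
  (collapse_length_le _).trans_eq (by simp)

theorem groupBy_within {R : Table Dom} (S : Finset (Fin k)) (h : R.Within V) :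
    (groupBy S R).val.Within V := by
  intro r hr a
  obtain ⟨s, hs, hsr⟩ := exists_mem_of_mem_collapse hr
  rw [← hsr]
  have hs := (sortT_perm _ _).mem_iff.1 hs
  rw [mapT_val] at hs
  obtain ⟨s', hs', rfl⟩ := List.mem_map.1 hs
  exact h s' hs' ⟨a, Finset.inter_subset_right (s₁ := S) a.2⟩

theorem groupBy_cost_le (S : Finset (Fin k)) (R : Table Dom) {e : ℕ}
    (h : R.rows.length ≤ 2 ^ e) :
    (groupBy S R).cost ≤ 4 * R.rows.length * e + 3 * R.rows.length + 4 := by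
  have hsort := sortT_cost_le (fun r : Tuple Dom (S ∩ R.schema) × ℕ => r.1)
    (mapT (fun r : Tuple Dom R.schema × ℕ =>
      (r.1.restrict (Finset.inter_subset_right (s₁ := S)), r.2)) R.rows).val e (by simpa using h)
  simp only [groupBy, Timed.cost_step, Timed.cost_bind, Timed.cost_pure, collapse_cost,
    sortT_length, mapT_cost]
  simp only [mapT_val, List.length_map] at hsort ⊢
  omega

theorem totalCount_map_restrict (S : Finset (Fin k)) {l : List (Tuple Dom S' × ℕ)}
    (h : ∀ r ∈ l, ∀ a : {a // a ∈ S'}, r.1 a ∈ V a) :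
    totalCount (· = Tuple.ofAssignment (S ∩ S') σ)
        (l.map fun r => (r.1.restrict (Finset.inter_subset_right (s₁ := S)), r.2)) =
      marg V (S' \ S) (fun τ => totalCount (· = Tuple.ofAssignment S' τ) l) σ := by
  induction l with
  | nil => simp [marg]
  | cons r l ih =>
    rw [List.map_cons, totalCount_cons, ih fun s hs => h s (List.mem_cons_of_mem _ hs)]
    simp only [marg, totalCount_cons, Finset.sum_add_distrib]
    congr 1
    have hr : r.1.restrict Finset.sdiff_subset ∈
        Fintype.piFinset fun a : {a // a ∈ S' \ S} => V a :=
      Fintype.mem_piFinset.2 fun a => h r List.mem_cons_self ⟨a, Finset.sdiff_subset a.2⟩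
    have hiff := Tuple.eq_ofAssignment_updateFinset_iff (σ := σ) (S := S) r.1
    split_ifs with h
    · refine (Finset.sum_eq_single_of_mem _ hr fun y _ hy => ?_).trans ?_ |>.symm
      · exact if_neg fun hry => hy ((hiff y).1 hry).2.symm
      · exact if_pos ((hiff _).2 ⟨h, rfl⟩)
    · exact (Finset.sum_eq_zero fun y _ => if_neg fun hy => h ((hiff y).1 hy).1).symm

theorem groupBy_weight (S : Finset (Fin k)) {R : Table Dom} (h : R.Within V) :
    (groupBy S R).val.weight = marg V (R.schema \ S) R.weight := by
  funext σ
  refine (totalCount_collapse _ _).trans ?_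
  refine (totalCount_eq_of_perm (sortT_perm _ _)).trans ?_
  rw [mapT_val]
  exact totalCount_map_restrict S h

variable {Q : Query k m} {i : Fin m}

@[simp] theorem countTable_schema (D : Database Q Dom) (i : Fin m) :
    (countTable D i).val.schema = Q i := Finset.inter_self _

theorem countTable_weight (D : Database Q Dom) (i : Fin m) (σ : ∀ a, Dom a) :
    (countTable D i).val.weight σ = (D i).count (Tuple.ofAssignment (Q i) σ) := by
  refine (totalCount_collapse _ _).trans ?_
  refine (totalCount_eq_of_perm (sortT_perm _ _)).trans ?_
  rw [mapT_val, mapT_val, List.map_map]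
  induction D i with
  | nil => rfl
  | cons t l ih =>
    refine (totalCount_cons _ _ _).trans ?_
    rw [ih, List.count_cons, add_comm]
    have hiff : t.restrict (Finset.inter_subset_right (s₁ := Q i)) =
        Tuple.ofAssignment (Q i ∩ Q i) σ ↔ t = Tuple.ofAssignment (Q i) σ := by
      simp only [Tuple.eq_ofAssignment_iff, Tuple.restrict, Finset.mem_inter, and_self]
    exact congrArg _ (if_congr (hiff.trans beq_iff_eq.symm) rfl rfl)

theorem countTable_length_le (D : Database Q Dom) (i : Fin m) :
    (countTable D i).val.rows.length ≤ (D i).length :=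
  (groupBy_length_le _ _).trans_eq (by simp)

theorem countTable_within {D : Database Q Dom}
    (h : ∀ t ∈ D i, ∀ a : {a // a ∈ Q i}, t a ∈ V a) : (countTable D i).val.Within V := by
  refine groupBy_within _ fun r hr a => ?_
  simp only [mapT_val, List.mem_map] at hr
  obtain ⟨t, ht, rfl⟩ := hr
  exact h t ht a

theorem countTable_cost_le (D : Database Q Dom) (i : Fin m) {e : ℕ} (h : (D i).length ≤ 2 ^ e) :
    (countTable D i).cost ≤ 4 * (D i).length * e + 4 * (D i).length + 6 := by
  have hgroup := groupBy_cost_le (Q i) ⟨Q i, (mapT (fun t => (t, 1)) (D i)).val⟩ (e := e)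
    (by simpa using h)
  simp only [countTable, Timed.cost_step, Timed.cost_bind, mapT_cost]
  simp only [mapT_val, List.length_map] at hgroup ⊢
  omega

end Tables

/-! ### Tuple sensitivity as a message -/

section Sensitivity

variable {k m : ℕ} {Dom : Fin k → Type u}

theorem Query.subset_attrs (Q : Query k m) (j : Fin m) : Q j ⊆ Q.attrs :=
  Finset.subset_biUnion_of_mem Q (Finset.mem_univ j)

theorem Query.biUnion_erase_sdiff (Q : Query k m) (i : Fin m) :
    (Finset.univ.erase i).biUnion Q \ Q i = Q.attrs \ Q i := by
  rw [Query.attrs, ← Finset.insert_erase (Finset.mem_univ i), Finset.biUnion_insert,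
    Finset.union_sdiff_left, Finset.erase_insert (Finset.notMem_erase _ _)]

section Counting

variable {α : Type u} [DecidableEq α]

theorem card_filter_toType_eq (s : Multiset α) (a : α) :
    (Finset.univ.filter fun y : s.ToType => y.1 = a).card = s.count a := by
  conv_rhs => rw [← Multiset.map_univ_coe s, Multiset.count_map]
  rw [Finset.card_def, Finset.filter_val]
  exact congrArg _ (Multiset.filter_congr fun _ _ => eq_comm)

theorem count_bagSymmDiff (s t : Multiset α) (a : α) :
    (bagSymmDiff s t).count a = max (s.count a - t.count a) (t.count a - s.count a) := by
  rw [bagSymmDiff, Multiset.count_union, Multiset.count_sub, Multiset.count_sub]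

end Counting

section Answer

variable [∀ a, LinearOrder (Dom a)] {Q : Query k m}

theorem compatible_and_outputRow_eq_iff {D : Instance Q Dom} (f : ∀ i, (D i).ToType)
    (u : Tuple Dom Q.attrs) :
    (Compatible f ∧ u = outputRow f) ↔ ∀ j, (f j).1 = u.restrict (Q.subset_attrs j) := by
  constructor
  · rintro ⟨hf, rfl⟩ j
    exact funext fun a => hf _ _ a _ _
  · refine fun h => ⟨fun i j a hi hj => ?_, funext fun a => ?_⟩
    · rw [h i, h j]
      rfl
    · have ha : ∃ i, (a : Fin k) ∈ Q i := by simpa [Query.attrs] using a.2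
      exact (congrFun (h ha.choose) ⟨a, ha.choose_spec⟩).symm

theorem count_answer (D : Instance Q Dom) (u : Tuple Dom Q.attrs) :
    (answer D).count u = ∏ j, (D j).count (u.restrict (Q.subset_attrs j)) := by
  classical
  rw [answer, Multiset.count_map, ← Finset.filter_val, ← Finset.card_def, Finset.filter_filter]
  simp only [compatible_and_outputRow_eq_iff, ← card_filter_toType_eq]
  rw [← Fintype.card_piFinset]
  congr 1
  ext f
  simp [Fintype.mem_piFinset]

theorem count_answer_update (D : Instance Q Dom) (i : Fin m) (B : Multiset (Tuple Dom (Q i)))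
    (u : Tuple Dom Q.attrs) :
    (answer (Q := Q) (Function.update D i B)).count u =
      B.count (u.restrict (Q.subset_attrs i)) *
        ∏ j ∈ Finset.univ.erase i, (D j).count (u.restrict (Q.subset_attrs j)) := by
  rw [count_answer, ← Finset.mul_prod_erase _ _ (Finset.mem_univ i), Function.update_self]
  congr 1
  refine Finset.prod_congr rfl fun j hj => ?_
  rw [Function.update_of_ne (Finset.ne_of_mem_erase hj)]

theorem count_answer_eq_mul_prod_erase (D : Instance Q Dom) (i : Fin m)
    (u : Tuple Dom Q.attrs) :
    (answer D).count u = (D i).count (u.restrict (Q.subset_attrs i)) *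
        ∏ j ∈ Finset.univ.erase i, (D j).count (u.restrict (Q.subset_attrs j)) := by
  rw [← count_answer_update, Function.update_eq_self]

theorem count_bagSymmDiff_insertTuple (D : Instance Q Dom) (i : Fin m) (t : Tuple Dom (Q i))
    (u : Tuple Dom Q.attrs) :
    (bagSymmDiff (answer (insertTuple D i t)) (answer D)).count u =
      if u.restrict (Q.subset_attrs i) = t then
        ∏ j ∈ Finset.univ.erase i, (D j).count (u.restrict (Q.subset_attrs j)) else 0 := by
  rw [count_bagSymmDiff, insertTuple, count_answer_update, count_answer_eq_mul_prod_erase D i,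
    Multiset.count_cons]
  split_ifs
  · rw [add_mul, one_mul]
    omega
  · simp

theorem count_bagSymmDiff_deleteTuple_le (D : Instance Q Dom) (i : Fin m) (t : Tuple Dom (Q i))
    (u : Tuple Dom Q.attrs) :
    (bagSymmDiff (answer D) (answer (deleteTuple D i t))).count u ≤
      if u.restrict (Q.subset_attrs i) = t then
        ∏ j ∈ Finset.univ.erase i, (D j).count (u.restrict (Q.subset_attrs j)) else 0 := by
  rw [count_bagSymmDiff, deleteTuple, count_answer_update, count_answer_eq_mul_prod_erase D i]
  split_ifs with h
  · rw [h, Multiset.count_erase_self]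
    cases (D i).count t with
    | zero => simp
    | succ c =>
      rw [Nat.add_sub_cancel, add_mul, one_mul]
      omega
  · rw [Multiset.count_erase_of_ne h]
    simp

theorem tupleSens_eq_upSens (D : Instance Q Dom) (t : Σ i, Tuple Dom (Q i)) :
    tupleSens D t = upSens D t := by
  refine max_eq_left (Multiset.card_le_card (Multiset.le_iff_count.2 fun u => ?_))
  exact (count_bagSymmDiff_deleteTuple_le D t.1 t.2 u).trans_eq
    (count_bagSymmDiff_insertTuple D t.1 t.2 u).symm

theorem mem_of_mem_bagSymmDiff_insertTuple {D : Instance Q Dom} {i : Fin m} {t : Tuple Dom (Q i)}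
    {u : Tuple Dom Q.attrs} (hu : u ∈ bagSymmDiff (answer (insertTuple D i t)) (answer D)) :
    u.restrict (Q.subset_attrs i) = t ∧ ∀ j ≠ i, u.restrict (Q.subset_attrs j) ∈ D j := by
  rw [← Multiset.count_ne_zero, count_bagSymmDiff_insertTuple, ite_ne_right_iff,
    Finset.prod_ne_zero_iff] at hu
  exact ⟨hu.1, fun j hj =>
    Multiset.count_ne_zero.1 (hu.2 j (Finset.mem_erase.2 ⟨hj, Finset.mem_univ j⟩))⟩

end Answer

variable [∀ a, Inhabited (Dom a)]

/-- A tuple, completed to a total assignment with default values. -/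
def Tuple.extend {S : Finset (Fin k)} (t : Tuple Dom S) : ∀ a, Dom a :=
  fun a => if h : a ∈ S then t ⟨a, h⟩ else default

theorem Tuple.eq_ofAssignment_updateFinset_extend_iff {S S' : Finset (Fin k)} (hS : S ⊆ S')
    (t : Tuple Dom S) (u : Tuple Dom S') (y : ∀ a : {a // a ∈ S' \ S}, Dom a) :
    u = ofAssignment S' (Function.updateFinset t.extend (S' \ S) y) ↔
      u.restrict hS = t ∧ u.restrict Finset.sdiff_subset = y := by
  refine (eq_ofAssignment_updateFinset_iff u y).trans (and_congr_left' ?_)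
  rw [eq_ofAssignment_iff]
  constructor
  · exact fun h => funext fun a => (h a (Finset.mem_inter.2 ⟨a.2, hS a.2⟩)).trans (dif_pos a.2)
  · rintro rfl a ha
    rw [extend, dif_pos (Finset.mem_inter.1 ha).1]
    rfl

variable [∀ a, LinearOrder (Dom a)] {Q : Query k m}

theorem tupleSens_eq_message {V : ∀ a, Finset (Dom a)} {D : Instance Q Dom}
    (hV : ∀ j, ∀ t ∈ D j, ∀ a : {a // a ∈ Q j}, t a ∈ V a) (i : Fin m) (t : Tuple Dom (Q i)) :
    tupleSens D ⟨i, t⟩ = message V Q (fun j σ => (D j).count (Tuple.ofAssignment (Q j) σ)) (Q i)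
      (Finset.univ.erase i) t.extend := by
  rw [tupleSens_eq_upSens, upSens, message, Q.biUnion_erase_sdiff, marg]
  set M := bagSymmDiff (answer (insertTuple D i t)) (answer D)
  let row (y : ∀ a : {a // a ∈ Q.attrs \ Q i}, Dom a) : Tuple Dom Q.attrs :=
    Tuple.ofAssignment Q.attrs (Function.updateFinset t.extend (Q.attrs \ Q i) y)
  have eq_row_iff := Tuple.eq_ofAssignment_updateFinset_extend_iff (Q.subset_attrs i) t
  have restrict_row (y) : (row y).restrict (Q.subset_attrs i) = t ∧
      (row y).restrict Finset.sdiff_subset = y := (eq_row_iff (row y) y).1 rfl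
  have row_injective : Function.Injective row := fun y y' h =>
    (restrict_row y).2.symm.trans (h ▸ (restrict_row y').2)
  have mem_image_row : ∀ u ∈ M, u ∈ (Fintype.piFinset fun a : {a // a ∈ Q.attrs \ Q i} =>
      V a).image row := by
    intro u hu
    obtain ⟨hut, huD⟩ := mem_of_mem_bagSymmDiff_insertTuple hu
    refine Finset.mem_image.2 ⟨u.restrict Finset.sdiff_subset, Fintype.mem_piFinset.2 ?_,
      ((eq_row_iff u _).2 ⟨hut, rfl⟩).symm⟩
    rintro ⟨a, ha⟩
    obtain ⟨haQ, hai⟩ := Finset.mem_sdiff.1 ha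
    obtain ⟨j, -, haj⟩ := Finset.mem_biUnion.1 haQ
    exact hV j _ (huD j fun hji => hai (hji ▸ haj)) ⟨a, haj⟩
  rw [← Multiset.sum_count_eq_card mem_image_row, Finset.sum_image row_injective.injOn]
  refine Finset.sum_congr rfl fun y _ => ?_
  rw [count_bagSymmDiff_insertTuple, if_pos (restrict_row y).1, Finset.prod_apply]
  rfl

end Sensitivity

/-! ### Trees recorded by GYO decompositions -/

namespace RTree

variable {α : Type v} {a b i x y : α} {T c : RTree α} {cs : List (RTree α)}

theorem induction_on {P : RTree α → Prop} (T : RTree α)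
    (node : ∀ a cs, (∀ c ∈ cs, P c) → P (node a cs)) : P T :=
  RTree.rec (motive_1 := P) (motive_2 := fun cs => ∀ c ∈ cs, P c) node (by simp)
    (fun _ _ hc hcs => List.forall_mem_cons.2 ⟨hc, hcs⟩) T

theorem nodesList_eq_flatMap (cs : List (RTree α)) : nodesList cs = cs.flatMap nodes := by
  induction cs with
  | nil => rfl
  | cons c cs ih => rw [nodesList, ih, List.flatMap_cons]

theorem mem_nodes_node : x ∈ (node a cs).nodes ↔ x = a ∨ ∃ c ∈ cs, x ∈ c.nodes := by
  rw [nodes, List.mem_cons, nodesList_eq_flatMap, List.mem_flatMap]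

theorem mem_edges_node {e : α × α} :
    e ∈ (node a cs).edges ↔ ∃ c ∈ cs, e = (a, c.label) ∨ e ∈ c.edges := by
  rw [edges]
  induction cs with
  | nil => simp [edgesList]
  | cons c cs ih => simp [edgesList, ih, or_assoc]

theorem label_mem_nodes (T : RTree α) : T.label ∈ T.nodes := by
  cases T
  exact List.mem_cons_self

theorem mem_nodes_of_mem_edges (h : (a, b) ∈ T.edges) : a ∈ T.nodes ∧ b ∈ T.nodes := by
  induction T using induction_on with
  | node x cs ih =>
    rw [mem_nodes_node, mem_nodes_node]
    obtain ⟨c, hc, h | h⟩ := mem_edges_node.1 h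
    · obtain ⟨rfl, rfl⟩ := Prod.mk.inj h
      exact ⟨Or.inl rfl, Or.inr ⟨c, hc, c.label_mem_nodes⟩⟩
    · exact ⟨Or.inr ⟨c, hc, (ih c hc h).1⟩, Or.inr ⟨c, hc, (ih c hc h).2⟩⟩

theorem graph_adj : T.graph.Adj a b ↔ a ≠ b ∧ ((a, b) ∈ T.edges ∨ (b, a) ∈ T.edges) :=
  SimpleGraph.fromRel_adj _ _ _

theorem mem_nodes_of_graph_adj (h : T.graph.Adj a b) : b ∈ T.nodes :=
  (graph_adj.1 h).2.elim (fun h => (mem_nodes_of_mem_edges h).2)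
    fun h => (mem_nodes_of_mem_edges h).1

section Nodup

variable (hT : (node i cs).nodes.Nodup)

include hT

theorem nodup_of_nodup_node (hc : c ∈ cs) : c.nodes.Nodup := by
  rw [nodes, nodesList_eq_flatMap, List.nodup_cons, List.nodup_flatMap] at hT
  exact hT.2.1 c hc

theorem notMem_nodes_of_nodup_node (hc : c ∈ cs) : i ∉ c.nodes := by
  rw [nodes, nodesList_eq_flatMap, List.nodup_cons] at hT
  exact fun hi => hT.1 (List.mem_flatMap.2 ⟨c, hc, hi⟩)

theorem eq_of_mem_nodes_of_nodup_node {c' : RTree α} (hc : c ∈ cs) (hc' : c' ∈ cs)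
    (hx : x ∈ c.nodes) (hx' : x ∈ c'.nodes) : c = c' := by
  rw [nodes, nodesList_eq_flatMap, List.nodup_cons, List.nodup_flatMap] at hT
  by_contra hne
  have : Std.Symm fun c c' : RTree α => c.nodes.Disjoint c'.nodes := ⟨fun _ _ h => h.symm⟩
  exact List.Pairwise.forall (R := fun c c' : RTree α => c.nodes.Disjoint c'.nodes) hT.2.2
    hc hc' hne hx hx'

theorem graph_adj_or_eq_of_graph_adj_node (hc : c ∈ cs) (hx : x ∈ c.nodes)
    (hxy : (node i cs).graph.Adj x y) : c.graph.Adj x y ∨ x = c.label ∧ y = i := by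
  obtain ⟨hne, h⟩ := graph_adj.1 hxy
  have hi := notMem_nodes_of_nodup_node hT hc
  rw [graph_adj]
  rcases h with h | h
  · obtain ⟨c', hc', h | h⟩ := mem_edges_node.1 h
    · exact absurd ((Prod.mk.inj h).1 ▸ hx) hi
    · obtain rfl := eq_of_mem_nodes_of_nodup_node hT hc hc' hx (mem_nodes_of_mem_edges h).1
      exact Or.inl ⟨hne, Or.inl h⟩
  · obtain ⟨c', hc', h | h⟩ := mem_edges_node.1 h
    · obtain ⟨rfl, rfl⟩ := Prod.mk.inj h
      obtain rfl := eq_of_mem_nodes_of_nodup_node hT hc hc' hx c'.label_mem_nodes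
      exact Or.inr ⟨rfl, rfl⟩
    · obtain rfl := eq_of_mem_nodes_of_nodup_node hT hc hc' hx (mem_nodes_of_mem_edges h).2
      exact Or.inl ⟨hne, Or.inr h⟩

end Nodup

variable [DecidableEq α]

theorem attachList_eq_map (j i : α) (cs : List (RTree α)) :
    attachList j i cs = cs.map (attach j i) := by
  induction cs with
  | nil => rfl
  | cons c cs ih => rw [attachList, ih, List.map_cons]

@[simp] theorem label_attach (j i : α) (T : RTree α) : (T.attach j i).label = T.label := by
  cases T
  rw [attach]
  rfl

theorem coe_nodes_attach (j i : α) (T : RTree α) :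
    ((T.attach j i).nodes : Multiset α) =
      Multiset.replicate (T.nodes.count j) i + (T.nodes : Multiset α) := by
  induction T using induction_on with
  | node a cs ih =>
    have nodesList_attach : (nodesList (attachList j i cs) : Multiset α) =
        Multiset.replicate ((nodesList cs).count j) i + (nodesList cs : Multiset α) := by
      induction cs with
      | nil => simp [attachList, nodesList]
      | cons c cs ihcs =>
        rw [attachList, nodesList, nodesList, ← Multiset.coe_add, ← Multiset.coe_add,
          ih c List.mem_cons_self, ihcs fun x hx => ih x (List.mem_cons_of_mem _ hx),
          List.count_append, Multiset.replicate_add]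
        ac_rfl
    rw [attach, nodes, nodes, ← Multiset.cons_coe, ← Multiset.cons_coe, List.count_cons]
    by_cases h : a = j
    · simp only [h, if_true, nodesList, nodes, beq_self_eq_true, List.cons_append,
        List.nil_append, ← Multiset.cons_coe, nodesList_attach, Multiset.replicate_succ,
        Multiset.cons_add, Multiset.add_cons]
    · simp only [h, if_false, nodesList_attach, beq_iff_eq, add_zero, Multiset.add_cons]

theorem mem_edges_node_attach {j : α} {e : α × α} (hc : c ∈ cs)
    (he : e = (a, c.label) ∨ e ∈ (c.attach j i).edges) : e ∈ ((node a cs).attach j i).edges := by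
  rw [attach, mem_edges_node]
  refine ⟨c.attach j i, ?_, by rwa [label_attach]⟩
  split_ifs <;> simp only [attachList_eq_map, List.mem_cons, List.mem_map]
  · exact Or.inr ⟨c, hc, rfl⟩
  · exact ⟨c, hc, rfl⟩

theorem edges_subset_edges_attach (j i : α) (T : RTree α) : T.edges ⊆ (T.attach j i).edges := by
  induction T using induction_on with
  | node a cs ih =>
    intro e he
    obtain ⟨c, hc, h⟩ := mem_edges_node.1 he
    exact mem_edges_node_attach hc (h.imp_right fun h => ih c hc h)

theorem graph_le_graph_attach (j i : α) (T : RTree α) : T.graph ≤ (T.attach j i).graph := by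
  intro a b hab
  rw [graph_adj] at hab ⊢
  exact hab.imp_right (Or.imp (T.edges_subset_edges_attach j i ·)
    (T.edges_subset_edges_attach j i ·))

theorem mem_edges_attach {j : α} (i : α) (hj : j ∈ T.nodes) : (j, i) ∈ (T.attach j i).edges := by
  induction T using induction_on with
  | node a cs ih =>
    by_cases h : a = j
    · rw [attach, mem_edges_node]
      exact ⟨node i [], by simp [h], Or.inl (by rw [h]; rfl)⟩
    · obtain ⟨c, hc, hjc⟩ := (mem_nodes_node.1 hj).resolve_left (Ne.symm h)
      exact mem_edges_node_attach hc (Or.inr (ih c hc hjc))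

end RTree

section Acyclic

variable {k m : ℕ} {Q : Query k m} {H H' : Finset (Fin m)} {T : RTree (Fin m)}
  {G G' : SimpleGraph (Fin m)} {i j l : Fin m}

theorem IsEar.exists_mem_erase (hi : IsEar Q H i) (hne : (H.erase i).Nonempty) :
    ∃ j ∈ H.erase i, ∀ a ∈ Q i, (∀ l ∈ H.erase i, a ∉ Q l) ∨ a ∈ Q j := by
  rcases hi.2 with h | ⟨j, hj, hji, h⟩
  · obtain ⟨j, hj⟩ := hne
    exact ⟨j, hj, fun a ha => Or.inl fun l hl =>
      h a ha l (Finset.mem_of_mem_erase hl) (Finset.ne_of_mem_erase hl)⟩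
  · exact ⟨j, Finset.mem_erase.2 ⟨hji, hj⟩, fun a ha => (h a ha).imp_left fun h l hl =>
      h l (Finset.mem_of_mem_erase hl) (Finset.ne_of_mem_erase hl)⟩

theorem GYOReduces.exists_gyoTree (h : GYOReduces Q H) (hH : H.Nonempty) :
    ∃ T, GYOTree Q H T := by
  induction h with
  | empty => simp at hH
  | @ear H i hi _ ih =>
    rw [← Finset.insert_erase hi.1]
    rcases (H.erase i).eq_empty_or_nonempty with hempty | hne
    · rw [hempty]
      exact ⟨_, GYOTree.last i⟩
    · obtain ⟨T, hT⟩ := ih hne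
      obtain ⟨j, hj, hij⟩ := hi.exists_mem_erase hne
      exact ⟨_, GYOTree.ear hT (Finset.notMem_erase i H) hj hij⟩

theorem GYOTree.coe_nodes_eq (h : GYOTree Q H T) : (T.nodes : Multiset (Fin m)) = H.val := by
  induction h with
  | last i => rfl
  | @ear H T i j _ hi hj _ ih =>
    have hcount : T.nodes.count j = 1 := by
      rw [← Multiset.coe_count, ih]
      exact Multiset.count_eq_one_of_mem H.nodup hj
    rw [RTree.coe_nodes_attach, hcount, ih, Finset.insert_val_of_notMem hi]
    rfl

theorem GYOTree.mem_nodes (h : GYOTree Q H T) : i ∈ T.nodes ↔ i ∈ H := by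
  rw [← Multiset.mem_coe, h.coe_nodes_eq, Finset.mem_val]

/-- Some path from `i` to `j` runs within `H`, and all its nodes contain the common attributes of
`i` and `j`. -/
def JoinPath (Q : Query k m) (G : SimpleGraph (Fin m)) (H : Finset (Fin m)) (i j : Fin m) : Prop :=
  ∃ p : G.Walk i j, p.IsPath ∧ ∀ l ∈ p.support, l ∈ H ∧ Q i ∩ Q j ⊆ Q l

theorem JoinPath.refl (hi : i ∈ H) : JoinPath Q G H i i :=
  ⟨.nil, by simp, by simpa using hi⟩

theorem JoinPath.symm (h : JoinPath Q G H i j) : JoinPath Q G H j i := by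
  obtain ⟨p, hp, hQ⟩ := h
  refine ⟨p.reverse, hp.reverse, fun l hl => ?_⟩
  rw [SimpleGraph.Walk.support_reverse, List.mem_reverse] at hl
  rw [Finset.inter_comm]
  exact hQ l hl

theorem JoinPath.mono (hG : G ≤ G') (hH : H ⊆ H') (h : JoinPath Q G H i j) :
    JoinPath Q G' H' i j := by
  obtain ⟨p, hp, hQ⟩ := h
  refine ⟨p.mapLe hG, (SimpleGraph.Walk.isPath_mapLe hG).2 hp, fun l hl => ?_⟩
  rw [SimpleGraph.Walk.support_mapLe_eq_support] at hl
  exact (hQ l hl).imp_left (hH ·)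

theorem JoinPath.cons (hadj : G.Adj i j) (hi : i ∉ H) (hij : Q i ∩ Q l ⊆ Q j)
    (h : JoinPath Q G H j l) : JoinPath Q G (insert i H) i l := by
  obtain ⟨p, hp, hQ⟩ := h
  refine ⟨.cons hadj p, (SimpleGraph.Walk.cons_isPath_iff _ _).2 ⟨hp, fun h => hi (hQ i h).1⟩,
    fun x hx => ?_⟩
  rw [SimpleGraph.Walk.support_cons, List.mem_cons] at hx
  rcases hx with rfl | hx
  · exact ⟨Finset.mem_insert_self _ _, Finset.inter_subset_left⟩
  · exact ⟨Finset.mem_insert_of_mem (hQ x hx).1,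
      (Finset.subset_inter hij Finset.inter_subset_right).trans (hQ x hx).2⟩

theorem GYOTree.joinPath (h : GYOTree Q H T) :
    ∀ i ∈ H, ∀ j ∈ H, JoinPath Q T.graph H i j := by
  induction h with
  | last i =>
    simp only [Finset.mem_singleton, forall_eq]
    exact .refl (Finset.mem_singleton_self i)
  | @ear H T i j hT hi hj hij ih =>
    have hle : T.graph ≤ (T.attach j i).graph := T.graph_le_graph_attach j i
    have hadj : (T.attach j i).graph.Adj i j :=
      RTree.graph_adj.2 ⟨fun h => hi (h ▸ hj),
        Or.inr (RTree.mem_edges_attach i (hT.mem_nodes.2 hj))⟩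
    have from_ear : ∀ y ∈ H, JoinPath Q (T.attach j i).graph (insert i H) i y := by
      refine fun y hy => .cons hadj hi (fun a ha => ?_) ((ih j hj y hy).mono hle subset_rfl)
      rw [Finset.mem_inter] at ha
      exact (hij a ha.1).resolve_left fun h => h y hy ha.2
    simp only [Finset.forall_mem_insert]
    exact ⟨⟨.refl (Finset.mem_insert_self _ _), from_ear⟩, fun x hx =>
      ⟨(from_ear x hx).symm, fun y hy => (ih x hx y hy).mono hle (Finset.subset_insert _ _)⟩⟩

theorem GYOTree.isJoinTree (h : GYOTree Q Finset.univ T) : IsJoinTree Q T where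
  nodes_perm := by
    rw [← Multiset.coe_eq_coe, h.coe_nodes_eq]
    rfl
  path i j := by
    obtain ⟨p, hp, hQ⟩ := h.joinPath i (Finset.mem_univ i) j (Finset.mem_univ j)
    exact ⟨p, hp, fun l hl => (hQ l hl).2⟩

/-- The running intersection property: the relations below a child share attributes with other
relations only via the child and its parent. Unlike a condition on paths, it is inherited by
subtrees. -/
inductive RunningIntersection (Q : Query k m) : RTree (Fin m) → Prop
  | node {i : Fin m} {cs : List (RTree (Fin m))} :
      (∀ c ∈ cs, ∀ x ∈ c.nodes, ∀ y ∉ c.nodes, Q x ∩ Q y ⊆ Q i ∩ Q c.label) →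
      (∀ c ∈ cs, RunningIntersection Q c) → RunningIntersection Q (.node i cs)

theorem runningIntersection_of_graph
    (hG : ∀ i j : Fin m, ∃ p : G.Walk i j, ∀ l ∈ p.support, Q i ∩ Q j ⊆ Q l)
    (hT : T.nodes.Nodup) (h : ∀ x ∈ T.nodes, ∀ y, G.Adj x y → T.graph.Adj x y ∨ x = T.label) :
    RunningIntersection Q T := by
  induction T using RTree.induction_on with
  | node i cs ih =>
    have adj_child : ∀ c ∈ cs, ∀ x ∈ c.nodes, ∀ y, G.Adj x y →
        c.graph.Adj x y ∨ x = c.label ∧ y = i := fun c hc x hx y hxy =>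
      RTree.graph_adj_or_eq_of_graph_adj_node hT hc hx <|
        (h x (RTree.mem_nodes_node.2 (Or.inr ⟨c, hc, hx⟩)) y hxy).resolve_right fun hxi : x = i =>
          RTree.notMem_nodes_of_nodup_node hT hc (hxi ▸ hx)
    refine .node (fun c hc x hx y hy => ?_) fun c hc => ih c hc
      (RTree.nodup_of_nodup_node hT hc) fun x hx y hxy => (adj_child c hc x hx y hxy).imp_right
        And.left
    -- A path from `x` to `y` leaves the subtree, which it can do only along the edge to the parent.
    obtain ⟨p, hp⟩ := hG x y
    obtain ⟨d, hd, hd₁, hd₂⟩ := p.exists_boundary_dart {z | z ∈ c.nodes} hx hy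
    rcases adj_child c hc _ hd₁ _ d.adj with hadj | ⟨hfst, hsnd⟩
    · exact absurd (RTree.mem_nodes_of_graph_adj hadj) hd₂
    · exact Finset.subset_inter (hsnd ▸ hp _ (p.dart_snd_mem_support_of_mem_darts hd))
        (hfst ▸ hp _ (p.dart_fst_mem_support_of_mem_darts hd))

theorem IsJoinTree.nodup (h : IsJoinTree Q T) : T.nodes.Nodup :=
  h.nodes_perm.nodup_iff.2 (List.nodup_finRange m)

theorem IsJoinTree.runningIntersection (h : IsJoinTree Q T) : RunningIntersection Q T :=
  runningIntersection_of_graph (fun i j => (h.path i j).imp fun _ hp => hp.2) h.nodup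
    fun _ _ _ hxy => Or.inl hxy

end Acyclic

/-! ### Iterated joins -/

section Joins

variable {k m : ℕ} {Dom : Fin k → Type u} [∀ a, LinearOrder (Dom a)] {V : ∀ a, Finset (Dom a)}
  {R R' : Table Dom} {l : List (Table Dom)} {N d e j : ℕ}

theorem joinFrom_weight (R : Table Dom) (l : List (Table Dom)) :
    (joinFrom R l).val.weight = R.weight * (l.map Table.weight).prod := by
  induction l generalizing R with
  | nil => exact (mul_one _).symm
  | cons R' l ih =>
    rw [List.map_cons, List.prod_cons, ← mul_assoc, ← join_weight, ← ih]
    rfl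

theorem joinFrom_within (h : R.Within V) (hl : ∀ R' ∈ l, R'.Within V) :
    (joinFrom R l).val.Within V := by
  induction l generalizing R with
  | nil => exact h
  | cons R' l ih =>
    rw [List.forall_mem_cons] at hl
    exact ih (join_within h hl.1) hl.2

theorem join_schema (h : R'.schema ⊆ R.schema) : (join R R').val.schema = R.schema :=
  Finset.union_eq_left.2 h

theorem joinFrom_schema (hl : ∀ R' ∈ l, R'.schema ⊆ R.schema) :
    (joinFrom R l).val.schema = R.schema := by
  induction l generalizing R with
  | nil => rfl
  | cons R' l ih =>
    rw [List.forall_mem_cons] at hl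
    have hschema := join_schema hl.1
    exact (ih (R := (join R R').val) (hschema ▸ hl.2)).trans hschema

theorem joinFrom_schema_subset {S : Finset (Fin k)} (h : R.schema ⊆ S)
    (hl : ∀ R' ∈ l, R'.schema ⊆ S) : (joinFrom R l).val.schema ⊆ S := by
  induction l generalizing R with
  | nil => exact h
  | cons R' l ih =>
    rw [List.forall_mem_cons] at hl
    exact ih (R := (join R R').val) (Finset.union_subset h hl.1) hl.2

theorem joinFrom_length_le
    (hl : ∀ R' ∈ l, R'.schema ⊆ R.schema ∧ (R'.rows.map Prod.fst).Nodup) :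
    (joinFrom R l).val.rows.length ≤ R.rows.length := by
  induction l generalizing R with
  | nil => exact le_rfl
  | cons R' l ih =>
    rw [List.forall_mem_cons] at hl
    exact (ih (R := (join R R').val) (join_schema hl.1.1 ▸ hl.2)).trans
      (join_length_le hl.1.2 hl.1.1)

theorem joinFrom_cost_le (hN : N ≤ 2 ^ e) (hR : R.rows.length ≤ N)
    (hl : ∀ R' ∈ l, R'.schema ⊆ R.schema ∧ (R'.rows.map Prod.fst).Nodup)
    (hlN : ∀ R' ∈ l, R'.rows.length ≤ N) :
    (joinFrom R l).cost ≤ l.length * (8 * (N * e) + 6 * N + 5) + 1 := by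
  induction l generalizing R with
  | nil => simp [joinFrom]
  | cons R' l ih =>
    rw [List.forall_mem_cons] at hl hlN
    have hlen := join_length_le hl.1.2 hl.1.1
    have hjoin := join_cost_le R R' (hR.trans hN) (hlN.1.trans hN)
    have hrest := ih (R := (join R R').val) (hlen.trans hR) (join_schema hl.1.1 ▸ hl.2) hlN.2
    have hRe := Nat.mul_le_mul_right e hR
    have hRe' := Nat.mul_le_mul_right e hlN.1
    simp only [joinFrom, Timed.cost_step, Timed.cost_bind, List.length_cons, add_mul, one_mul,
      mul_assoc] at hjoin hrest ⊢
    omega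

theorem join_length_le_pow_succ (hR : R.rows.length ≤ N ^ j) (hR' : R'.rows.length ≤ N) :
    (join R R').val.rows.length ≤ N ^ (j + 1) :=
  (join_length_le_mul R R').trans (Nat.mul_le_mul hR hR')

theorem joinFrom_length_le_pow (hR : R.rows.length ≤ N ^ j)
    (hl : ∀ R' ∈ l, R'.rows.length ≤ N) :
    (joinFrom R l).val.rows.length ≤ N ^ (j + l.length) := by
  induction l generalizing R j with
  | nil => exact hR
  | cons R' l ih =>
    rw [List.forall_mem_cons] at hl
    rw [List.length_cons, add_comm l.length, ← add_assoc]
    exact ih (join_length_le_pow_succ hR hl.1) hl.2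

theorem pos_of_two_le_of_le_two_pow (hN : N ≤ 2 ^ e) (hN₂ : 2 ≤ N) : 0 < e :=
  Nat.pos_of_ne_zero fun h => absurd (hN₂.trans hN) (by simp [h])

theorem join_cost_le_pow (hN : N ≤ 2 ^ e) (hN₂ : 2 ≤ N) (hj : 1 ≤ j)
    (hR : R.rows.length ≤ N ^ j) (hR' : R'.rows.length ≤ N) :
    (join R R').cost + 1 + 18 * (j * e * N ^ j) ≤ 18 * (j * e * N ^ (j + 1)) := by
  have hje : 0 < j * e := Nat.mul_pos hj (pos_of_two_le_of_le_two_pow hN hN₂)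
  have hRexp : R.rows.length ≤ 2 ^ (j * e) := by
    rw [mul_comm, pow_mul]
    exact hR.trans (Nat.pow_le_pow_left hN j)
  have hjoin := join_cost_le R R' hRexp (hR'.trans hN)
  have hlen := join_length_le_pow_succ hR hR'
  have hpow : N ^ j ≤ j * e * N ^ j := Nat.le_mul_of_pos_left _ hje
  have hNpow : N ≤ N ^ j := Nat.le_self_pow (by omega) N
  have hsort : R.rows.length * (j * e) ≤ j * e * N ^ j := by
    rw [mul_comm]
    gcongr
  have hsort' : R'.rows.length * e ≤ j * e * N ^ j :=
    calc R'.rows.length * e ≤ N ^ j * (j * e) :=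
          Nat.mul_le_mul (hR'.trans hNpow) (Nat.le_mul_of_pos_left _ hj)
      _ = j * e * N ^ j := mul_comm _ _
  have hdouble : 2 * (j * e * N ^ j) ≤ j * e * N ^ (j + 1) :=
    calc 2 * (j * e * N ^ j) = j * e * (N ^ j * 2) := by ring
      _ ≤ j * e * N ^ (j + 1) := by rw [pow_succ]; gcongr
  have hpow_succ : N ^ (j + 1) ≤ j * e * N ^ (j + 1) := Nat.le_mul_of_pos_left _ hje
  rw [mul_assoc, mul_assoc] at hjoin
  omega

/- Only the last join costs as much as the bound: the sizes of the intermediate tables grow at least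
geometrically. The second summand on the left makes the costs telescope. -/
theorem joinFrom_cost_le_pow (hN : N ≤ 2 ^ e) (hN₂ : 2 ≤ N) (hj : 1 ≤ j)
    (hR : R.rows.length ≤ N ^ j) (hl : ∀ R' ∈ l, R'.rows.length ≤ N) :
    (joinFrom R l).cost + 18 * ((j + l.length) * e * N ^ j) ≤
      18 * ((j + l.length) * e * N ^ (j + l.length)) + 1 := by
  induction l generalizing R j with
  | nil => simp [joinFrom, Nat.add_comm]
  | cons R' l ih =>
    rw [List.forall_mem_cons] at hl
    have hrest := ih (Nat.le_add_left 1 j) (join_length_le_pow_succ hR hl.1) hl.2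
    have hjoin := join_cost_le_pow hN hN₂ hj hR hl.1
    have hmono : (l.length + 1) * e * N ^ j ≤ (l.length + 1) * e * N ^ (j + 1) := by
      gcongr <;> omega
    have hexp : j + 1 + l.length = j + (l.length + 1) := by omega
    simp only [joinFrom, Timed.cost_step, Timed.cost_bind, List.length_cons]
    rw [hexp, add_mul, add_mul, mul_add] at hrest
    rw [add_mul, add_mul (j * e), mul_add]
    omega

theorem joinAll_weight (l : List (Table Dom)) :
    (joinAll l).val.weight = (l.map Table.weight).prod := by
  cases l with
  | nil =>
    funext σ
    exact (totalCount_cons _ _ _).trans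
      (if_pos (funext fun a => absurd a.2 (Finset.notMem_empty _)))
  | cons R l => exact joinFrom_weight R l

theorem joinAll_within (hl : ∀ R ∈ l, R.Within V) : (joinAll l).val.Within V := by
  cases l with
  | nil => exact fun _ _ a => absurd a.2 (Finset.notMem_empty _)
  | cons R l =>
    rw [List.forall_mem_cons] at hl
    exact joinFrom_within hl.1 hl.2

theorem joinAll_schema_subset {S : Finset (Fin k)} (hl : ∀ R ∈ l, R.schema ⊆ S) :
    (joinAll l).val.schema ⊆ S := by
  cases l with
  | nil => exact Finset.empty_subset S
  | cons R l =>
    rw [List.forall_mem_cons] at hl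
    exact joinFrom_schema_subset hl.1 hl.2

theorem joinAll_length_le (hN : 1 ≤ N) (hd : l.length ≤ d) (hl : ∀ R ∈ l, R.rows.length ≤ N) :
    (joinAll l).val.rows.length ≤ N ^ d := by
  refine le_trans ?_ (Nat.pow_le_pow_right hN hd)
  cases l with
  | nil => exact le_rfl
  | cons R l =>
    rw [List.forall_mem_cons, ← pow_one N] at hl
    rw [List.length_cons, add_comm]
    exact joinFrom_length_le_pow hl.1 (pow_one N ▸ hl.2)

theorem joinAll_cost_le (hN : N ≤ 2 ^ e) (hN₂ : 2 ≤ N) (hd : l.length ≤ d)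
    (hl : ∀ R ∈ l, R.rows.length ≤ N) :
    (joinAll l).cost ≤ 18 * (d * e * N ^ d) + 2 := by
  cases l with
  | nil => simp [joinAll]
  | cons R l =>
    rw [List.forall_mem_cons] at hl
    rw [List.length_cons, add_comm] at hd
    have hjoin := joinFrom_cost_le_pow hN hN₂ le_rfl (hl.1.trans_eq (pow_one N).symm) hl.2
    have hmono : (1 + l.length) * e * N ^ (1 + l.length) ≤ d * e * N ^ d := by
      gcongr
      omega
    simp only [joinAll, Timed.cost_step]
    omega

end Joins

/-! ### Tables that hold messages -/

section Representation

variable {k m : ℕ} {Dom : Fin k → Type u} {Q : Query k m} {V : ∀ a, Finset (Dom a)}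

/-- All values that occur in the database belong to `V`. -/
def Database.Within (V : ∀ a, Finset (Dom a)) (D : Database Q Dom) : Prop :=
  ∀ j, ∀ t ∈ D j, ∀ a : {a // a ∈ Q j}, t a ∈ V a

theorem Database.length_le_size (D : Database Q Dom) (i : Fin m) : (D i).length ≤ D.size :=
  Finset.single_le_sum (f := fun i => (D i).length) (fun _ _ => Nat.zero_le _)
    (Finset.mem_univ i)

variable [∀ a, LinearOrder (Dom a)]

/-- The multiplicity of an assignment in the relation `j`. -/
noncomputable def relWeight (D : Database Q Dom) (j : Fin m) (σ : ∀ a, Dom a) : ℕ :=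
  (D j).count (Tuple.ofAssignment (Q j) σ)

theorem relWeight_dependsOn (D : Database Q Dom) (j : Fin m) : DependsOn (relWeight D j) (Q j) :=
  fun _ _ h => congrArg (D j).count (Tuple.dependsOn_ofAssignment h)

/-- The table `R` holds the message that the relations in `X` send to the attributes in `S`. -/
structure Table.Represents (V : ∀ a, Finset (Dom a)) (D : Database Q Dom) (R : Table Dom)
    (S : Finset (Fin k)) (X : Finset (Fin m)) : Prop where
  schema_subset : R.schema ⊆ S
  nodup : (R.rows.map Prod.fst).Nodup
  within : R.Within V
  length_le : R.rows.length ≤ D.size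
  weight_eq : R.weight = message V Q (relWeight D) S X

/-- The tables hold the messages to `S` from the blocks of a partition of `X`. Each block shares
attributes with other relations only within `S`, so that the product of the messages is the message
from `X`. -/
inductive Covers (V : ∀ a, Finset (Dom a)) (D : Database Q Dom) (S : Finset (Fin k)) :
    List (Table Dom) → Finset (Fin m) → Prop
  | nil : Covers V D S [] ∅
  | cons {R : Table Dom} {l : List (Table Dom)} {X Y : Finset (Fin m)} :
      R.Represents V D S X → (∀ x ∈ X, ∀ y ∉ X, Q x ∩ Q y ⊆ S) → Disjoint X Y →
      Covers V D S l Y → Covers V D S (R :: l) (X ∪ Y)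

variable {D : Database Q Dom} {S P G : Finset (Fin k)} {l l' : List (Table Dom)} {R : Table Dom}
  {X Y : Finset (Fin m)} {i : Fin m} {e : ℕ}

theorem Covers.append (h : Covers V D S l X) (h' : Covers V D S l' Y) (hXY : Disjoint X Y) :
    Covers V D S (l ++ l') (X ∪ Y) := by
  induction h with
  | nil => rwa [List.nil_append, Finset.empty_union]
  | cons hR hX hdisj _ ih =>
    rw [Finset.disjoint_union_left] at hXY
    rw [List.cons_append, Finset.union_assoc]
    exact .cons hR hX (Finset.disjoint_union_right.2 ⟨hdisj, hXY.1⟩) (ih hXY.2)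

theorem Covers.exists_represents (h : Covers V D S l X) (hR : R ∈ l) :
    ∃ Y, R.Represents V D S Y := by
  induction h with
  | nil => simp at hR
  | cons hR' _ _ _ ih =>
    rcases List.mem_cons.1 hR with rfl | hR
    · exact ⟨_, hR'⟩
    · exact ih hR

theorem Covers.within (h : Covers V D S l X) (hR : R ∈ l) : R.Within V :=
  (h.exists_represents hR).elim fun _ hR => hR.within

theorem Covers.length_le (h : Covers V D S l X) (hR : R ∈ l) : R.rows.length ≤ D.size :=
  (h.exists_represents hR).elim fun _ hR => hR.length_le

theorem Covers.schema_subset_and_nodup (h : Covers V D (Q i) l X) (hR : R ∈ l) :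
    R.schema ⊆ (countTable D i).val.schema ∧ (R.rows.map Prod.fst).Nodup :=
  (h.exists_represents hR).elim fun _ hR => ⟨hR.schema_subset.trans_eq (countTable_schema D i).symm,
    hR.nodup⟩

theorem Covers.prod_weight (h : Covers V D S l X) :
    (l.map Table.weight).prod = message V Q (relWeight D) S X := by
  induction h with
  | nil => rw [List.map_nil, List.prod_nil, message_empty]
  | cons hR hX hXY _ ih =>
    rw [List.map_cons, List.prod_cons, hR.weight_eq, ih]
    exact message_mul_message (relWeight_dependsOn D) hXY fun x hx y hy =>
      hX x hx y (Finset.disjoint_right.1 hXY hy)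

theorem Covers.groupBy_joinFrom (h : Covers V D (Q i) l X) (hV : D.Within V) (hi : i ∉ X)
    (hGP : G ⊆ P) (hG : Q i \ G = Q i \ P) (hP : ∀ x ∈ X, Q x ∩ P ⊆ Q i) :
    (groupBy G (joinFrom (countTable D i).val l).val).val.Represents V D P (insert i X) where
  schema_subset := Finset.inter_subset_left.trans hGP
  nodup := groupBy_nodup _ _
  within := groupBy_within _ (joinFrom_within (countTable_within (hV i)) fun _ => h.within)
  length_le := (groupBy_length_le _ _).trans
    ((joinFrom_length_le fun _ => h.schema_subset_and_nodup).trans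
      ((countTable_length_le D i).trans (D.length_le_size i)))
  weight_eq := by
    have hwithin := joinFrom_within (countTable_within (hV i)) fun _ => h.within
    have hcount : (countTable D i).val.weight = relWeight D i := funext (countTable_weight D i)
    rw [groupBy_weight G hwithin, joinFrom_schema fun _ hR => (h.schema_subset_and_nodup hR).1,
      countTable_schema, hG, joinFrom_weight, hcount, h.prod_weight,
      marg_mul_message (relWeight_dependsOn D) hi hP]

theorem Covers.groupBy_joinFrom_cost_le (h : Covers V D (Q i) l X) (G : Finset (Fin k))
    (he : D.size ≤ 2 ^ e) (hpos : 0 < D.size * e) :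
    (joinFrom (countTable D i).val l).cost +
      (groupBy G (joinFrom (countTable D i).val l).val).cost ≤
      (19 * l.length + 12) * (D.size * e) := by
  have hR := (countTable_length_le D i).trans (D.length_le_size i)
  have hlen := (joinFrom_length_le (R := (countTable D i).val)
    fun _ => h.schema_subset_and_nodup).trans hR
  have hjoin := joinFrom_cost_le he hR (fun _ => h.schema_subset_and_nodup) fun _ => h.length_le
  have hgroup := groupBy_cost_le G _ (hlen.trans he)
  have hsize : D.size ≤ D.size * e := Nat.le_mul_of_pos_right _ (Nat.pos_of_mul_pos_left hpos)
  have hjoins : l.length * (8 * (D.size * e) + 6 * D.size + 5) ≤ l.length * (19 * (D.size * e)) :=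
    Nat.mul_le_mul_left _ (by omega)
  have hsort := Nat.mul_le_mul_right e hlen
  rw [mul_assoc] at hgroup
  rw [add_mul, mul_assoc, mul_left_comm]
  omega

end Representation

/-! ### The botjoins -/

namespace RTree

variable {α : Type v} {a : α} {cs : List (RTree α)} {d e : ℕ}

theorem length_add_le_of_maxDegreeAux_le (h : maxDegreeAux e (node a cs) ≤ d) :
    cs.length + e ≤ d := by
  rw [maxDegreeAux] at h
  exact (le_max_left _ _).trans h

theorem maxDegreeAux_one_le (h : maxDegreeAux e (node a cs) ≤ d) :
    ∀ c ∈ cs, maxDegreeAux 1 c ≤ d := by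
  rw [maxDegreeAux] at h
  replace h := (le_max_right _ _).trans h
  induction cs with
  | nil => simp
  | cons c cs ih =>
    rw [maxDegreeList] at h
    exact List.forall_mem_cons.2 ⟨(le_max_left _ _).trans h, ih ((le_max_right _ _).trans h)⟩

theorem length_nodes_node (a : α) (cs : List (RTree α)) :
    (node a cs).nodes.length = (cs.map fun c => c.nodes.length).sum + 1 := by
  rw [nodes, nodesList_eq_flatMap, List.length_cons, List.length_flatMap]

end RTree

theorem sum_map_le_mul_sum_map {α : Type*} {l : List α} {f g : α → ℕ} {K : ℕ}
    (h : ∀ a ∈ l, f a ≤ K * g a) : (l.map f).sum ≤ K * (l.map g).sum := by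
  rw [← List.sum_map_mul_left]
  exact List.sum_le_sum h

section BotPass

variable {k m : ℕ} {Dom : Fin k → Type u} [∀ a, LinearOrder (Dom a)] {Q : Query k m}

theorem botPassList_val (D : Database Q Dom) (P : Finset (Fin k)) (cs : List (RTree (Fin m))) :
    (botPassList D P cs).val = cs.map fun c => (botPass D P c).val := by
  induction cs with
  | nil => rw [botPassList]; rfl
  | cons c cs ih =>
    simp only [botPassList, Timed.val_step, Timed.val_bind, Timed.val_pure, ih, List.map_cons]

theorem botPassList_cost (D : Database Q Dom) (P : Finset (Fin k)) (cs : List (RTree (Fin m))) :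
    (botPassList D P cs).cost = (cs.map fun c => (botPass D P c).cost).sum + cs.length + 1 := by
  induction cs with
  | nil => rw [botPassList]; rfl
  | cons c cs ih =>
    simp only [botPassList, Timed.cost_step, Timed.cost_bind, Timed.cost_pure, ih, List.map_cons,
      List.sum_cons, List.length_cons]
    omega

/-- The botjoin `⊥(R_i)` at the root of the tree, where `P` is the attribute set of its parent. -/
noncomputable def botjoin (D : Database Q Dom) (P : Finset (Fin k)) (T : RTree (Fin m)) :
    Table Dom :=
  (botPass D P T).val.label.bot

theorem botjoin_node (D : Database Q Dom) (P : Finset (Fin k)) (i : Fin m)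
    (cs : List (RTree (Fin m))) :
    botjoin D P (.node i cs) = (groupBy (Q i ∩ P)
      (joinFrom (countTable D i).val (cs.map (botjoin D (Q i)))).val).val := by
  simp only [botjoin, botPass, Timed.val_step, Timed.val_bind, Timed.val_pure, mapT_val,
    botPassList_val, List.map_map]
  rfl

theorem botPass_val (D : Database Q Dom) (P : Finset (Fin k)) (i : Fin m)
    (cs : List (RTree (Fin m))) :
    (botPass D P (.node i cs)).val = .node ⟨i, (countTable D i).val, botjoin D P (.node i cs)⟩
      (cs.map fun c => (botPass D (Q i) c).val) := by
  simp only [botjoin_node, botPass, Timed.val_step, Timed.val_bind, Timed.val_pure, mapT_val,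
    botPassList_val, List.map_map]
  rfl

theorem botPass_cost (D : Database Q Dom) (P : Finset (Fin k)) (i : Fin m)
    (cs : List (RTree (Fin m))) :
    (botPass D P (.node i cs)).cost = (cs.map fun c => (botPass D (Q i) c).cost).sum +
      (countTable D i).cost + 2 * cs.length + 3 +
      ((joinFrom (countTable D i).val (cs.map (botjoin D (Q i)))).cost +
        (groupBy (Q i ∩ P) (joinFrom (countTable D i).val (cs.map (botjoin D (Q i)))).val).cost)
      := by
  have hbots : (cs.map fun c => (botPass D (Q i) c).val).map (fun c => c.label.bot) =
      cs.map (botjoin D (Q i)) := List.map_map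
  simp only [botPass, Timed.cost_step, Timed.cost_bind, Timed.cost_pure, mapT_val, mapT_cost,
    botPassList_val, botPassList_cost, hbots, List.length_map]
  omega

theorem botPass_label_idx (D : Database Q Dom) (P : Finset (Fin k)) (T : RTree (Fin m)) :
    (botPass D P T).val.label.idx = T.label := by
  cases T
  rw [botPass_val]
  rfl

theorem botPass_nodes (D : Database Q Dom) (P : Finset (Fin k)) (T : RTree (Fin m)) :
    (botPass D P T).val.nodes.map BotInfo.idx = T.nodes := by
  induction T using RTree.induction_on generalizing P with
  | node i cs ih =>
    rw [botPass_val, RTree.nodes, RTree.nodes, List.map_cons, RTree.nodesList_eq_flatMap,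
      RTree.nodesList_eq_flatMap, List.map_flatMap, List.flatMap_map]
    congr 1
    exact List.flatMap_congr fun c hc => ih c hc (Q i)

theorem RunningIntersection.separated {i : Fin m} {cs : List (RTree (Fin m))}
    (h : RunningIntersection Q (.node i cs)) : ∀ c ∈ cs, ∀ x ∈ c.nodes, ∀ y ∉ c.nodes,
      Q x ∩ Q y ⊆ Q i ∩ Q c.label := by
  cases h with
  | node h _ => exact h

theorem RunningIntersection.child {i : Fin m} {cs : List (RTree (Fin m))}
    (h : RunningIntersection Q (.node i cs)) : ∀ c ∈ cs, RunningIntersection Q c := by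
  cases h with
  | node _ h => exact h

variable {V : ∀ a, Finset (Dom a)} {D : Database Q Dom} {S P : Finset (Fin k)} {i : Fin m}
  {cs cs' : List (RTree (Fin m))} {T : RTree (Fin m)}

theorem covers_of_represents (hn : (RTree.nodesList cs).Nodup)
    (hS : ∀ c ∈ cs, ∀ x ∈ c.nodes, ∀ y ∉ c.nodes, Q x ∩ Q y ⊆ S)
    (h : ∀ c ∈ cs, (botjoin D S c).Represents V D S c.nodes.toFinset) :
    Covers V D S (cs.map (botjoin D S)) (RTree.nodesList cs).toFinset := by
  induction cs with
  | nil => exact .nil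
  | cons c cs ih =>
    rw [RTree.nodesList, List.nodup_append'] at hn
    rw [List.forall_mem_cons] at hS h
    rw [RTree.nodesList, List.toFinset_append]
    exact .cons h.1 (by simpa only [List.mem_toFinset] using hS.1)
      (List.disjoint_toFinset_iff_disjoint.2 hn.2.2) (ih hn.2.1 hS.2 h.2)

theorem botjoin_represents (hV : D.Within V) (hn : T.nodes.Nodup) (hr : RunningIntersection Q T)
    (hP : ∀ x ∈ T.nodes, Q x ∩ P ⊆ Q T.label) :
    (botjoin D P T).Represents V D P T.nodes.toFinset := by
  induction T using RTree.induction_on generalizing P with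
  | node i cs ih =>
    have hcovers : Covers V D (Q i) (cs.map (botjoin D (Q i))) (RTree.nodesList cs).toFinset :=
      covers_of_represents (List.nodup_cons.1 hn).2
        (fun c hc x hx y hy => (hr.separated c hc x hx y hy).trans Finset.inter_subset_left)
        fun c hc => ih c hc (RTree.nodup_of_nodup_node hn hc) (hr.child c hc) fun x hx =>
          (hr.separated c hc x hx i (RTree.notMem_nodes_of_nodup_node hn hc)).trans
            Finset.inter_subset_right
    rw [RTree.nodes, List.toFinset_cons, botjoin_node]
    exact hcovers.groupBy_joinFrom hV (fun hi => (List.nodup_cons.1 hn).1 (List.mem_toFinset.1 hi))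
      Finset.inter_subset_right (Finset.sdiff_inter_self_left _ _)
      fun x hx => hP x (List.mem_cons_of_mem _ (List.mem_toFinset.1 hx))

theorem covers_botjoins (hV : D.Within V) (hn : (RTree.node i cs).nodes.Nodup)
    (hr : RunningIntersection Q (.node i cs)) (h : cs'.Sublist cs) :
    Covers V D (Q i) (cs'.map (botjoin D (Q i))) (RTree.nodesList cs').toFinset := by
  refine covers_of_represents ?_
    (fun c hc x hx y hy => (hr.separated c (h.subset hc) x hx y hy).trans Finset.inter_subset_left)
    fun c hc => botjoin_represents hV (RTree.nodup_of_nodup_node hn (h.subset hc))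
      (hr.child c (h.subset hc)) fun x hx => (hr.separated c (h.subset hc) x hx i
        (RTree.notMem_nodes_of_nodup_node hn (h.subset hc))).trans Finset.inter_subset_right
  rw [RTree.nodes, List.nodup_cons, RTree.nodesList_eq_flatMap] at hn
  rw [RTree.nodesList_eq_flatMap]
  exact hn.2.sublist (h.flatMap _)

theorem botPass_cost_le (hV : D.Within V) {d e b : ℕ} (he : D.size ≤ 2 ^ e)
    (hpos : 0 < D.size * e) (hd : 0 < d) (hn : T.nodes.Nodup) (hr : RunningIntersection Q T)
    (hb : T.maxDegreeAux b ≤ d) :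
    (botPass D P T).cost ≤ 50 * (d * (D.size * e)) * T.nodes.length := by
  induction T using RTree.induction_on generalizing P b with
  | node i cs ih =>
    have hchildren : (cs.map fun c => (botPass D (Q i) c).cost).sum ≤
        50 * (d * (D.size * e)) * (cs.map fun c => c.nodes.length).sum :=
      sum_map_le_mul_sum_map fun c hc => ih c hc (RTree.nodup_of_nodup_node hn hc)
        (hr.child c hc) (RTree.maxDegreeAux_one_le hb c hc)
    have hlen := RTree.length_add_le_of_maxDegreeAux_le hb
    have hjoin : _ ≤ 31 * (d * (D.size * e)) :=
      ((covers_botjoins hV hn hr (.refl cs)).groupBy_joinFrom_cost_le (Q i ∩ P) he hpos).trans <| by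
        rw [← mul_assoc 31 d, List.length_map]
        exact Nat.mul_le_mul_right _ (by omega)
    have hcount := countTable_cost_le D i ((D.length_le_size i).trans he)
    have hrows := D.length_le_size i
    have hsort := Nat.mul_le_mul_right e hrows
    have hsize : D.size ≤ D.size * e := Nat.le_mul_of_pos_right _ (Nat.pos_of_mul_pos_left hpos)
    have hdegree : cs.length ≤ d * (D.size * e) :=
      (le_add_right le_rfl).trans (hlen.trans (Nat.le_mul_of_pos_right _ hpos))
    have hunit : D.size * e ≤ d * (D.size * e) := Nat.le_mul_of_pos_left _ hd
    rw [mul_assoc] at hcount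
    rw [botPass_cost, RTree.length_nodes_node, mul_add, mul_one]
    omega

end BotPass

/-! ### The topjoins -/

section TopPass

variable {k m : ℕ} {Dom : Fin k → Type u} [∀ a, LinearOrder (Dom a)] {Q : Query k m}

/-- The topjoin `⊤(R_j)` at a child `j` of the node `p`, where `l` holds the topjoin of `p` and the
botjoins of the siblings of `j`. -/
noncomputable def topjoin (Q : Query k m) (p : BotInfo m Dom) (l : List (Table Dom)) (j : Fin m) :
    Timed (Table Dom) := do
  let J ← joinFrom p.rel l
  groupBy (Q j ∩ Q p.idx) J

section TopPassList

variable {α : Type v} {f : α → RTree (BotInfo m Dom)} {p : BotInfo m Dom}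
  {top : Option (Table Dom)} {left : List (Table Dom)} {c : α} {cs : List α}

theorem topPassList_cons_val :
    (topPassList Q p top left ((c :: cs).map f)).val =
      (topPass Q (some (topjoin Q p
        (top.toList ++ (left.reverse ++ cs.map fun c => (f c).label.bot))
        (f c).label.idx).val) (f c)).val ::
      (topPassList Q p top ((f c).label.bot :: left) (cs.map f)).val := by
  simp only [List.map_cons, topPassList, Timed.val_step, Timed.val_bind, Timed.val_pure, mapT_val,
    revAppendT_val, List.map_map]
  rfl

theorem topPassList_cons_cost :
    (topPassList Q p top left ((c :: cs).map f)).cost =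
      left.length + cs.length + 3 +
      (topjoin Q p (top.toList ++ (left.reverse ++ cs.map fun c => (f c).label.bot))
        (f c).label.idx).cost +
      (topPass Q (some (topjoin Q p
        (top.toList ++ (left.reverse ++ cs.map fun c => (f c).label.bot))
        (f c).label.idx).val) (f c)).cost +
      (topPassList Q p top ((f c).label.bot :: left) (cs.map f)).cost := by
  have hbots : (cs.map f).map (fun c => c.label.bot) = cs.map fun c => (f c).label.bot :=
    List.map_map
  simp only [List.map_cons, topPassList, topjoin, Timed.cost_step, Timed.cost_bind,
    Timed.cost_pure, Timed.val_bind, mapT_val, mapT_cost, revAppendT_val, revAppendT_cost, hbots,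
    List.length_map]
  omega

theorem exists_of_mem_topPassList {c' : RTree (TopInfo m Dom)}
    (h : c' ∈ (topPassList Q p top left (cs.map f)).val) :
    ∃ pre c suf, cs = pre ++ c :: suf ∧ c' = (topPass Q (some (topjoin Q p
      (top.toList ++ (left.reverse ++ (pre ++ suf).map fun c => (f c).label.bot))
      (f c).label.idx).val) (f c)).val := by
  induction cs generalizing left with
  | nil => simp [topPassList] at h
  | cons c cs ih =>
    rw [topPassList_cons_val] at h
    rcases List.mem_cons.1 h with rfl | h
    · exact ⟨[], c, cs, rfl, rfl⟩
    · obtain ⟨pre, c', suf, rfl, rfl⟩ := ih h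
      exact ⟨c :: pre, c', suf, rfl, by simp⟩

theorem topPassList_cost_le {K : α → ℕ} (h : ∀ pre c suf, cs = pre ++ c :: suf →
      left.length + pre.length + suf.length + 3 +
        (topjoin Q p (top.toList ++ (left.reverse ++ (pre ++ suf).map fun c => (f c).label.bot))
          (f c).label.idx).cost +
        (topPass Q (some (topjoin Q p
          (top.toList ++ (left.reverse ++ (pre ++ suf).map fun c => (f c).label.bot))
          (f c).label.idx).val) (f c)).cost ≤ K c) :
    (topPassList Q p top left (cs.map f)).cost ≤ (cs.map K).sum + 1 := by
  induction cs generalizing left with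
  | nil => simp [topPassList]
  | cons c cs ih =>
    have hhead := h [] c cs rfl
    have htail := ih (left := (f c).label.bot :: left) fun pre c' suf hcs => by
      have hc' := h (c :: pre) c' suf (by rw [hcs, List.cons_append])
      simpa [add_assoc, add_comm, add_left_comm] using hc'
    rw [topPassList_cons_cost, List.map_cons, List.sum_cons]
    simp only [List.nil_append, List.length_nil] at hhead
    omega

end TopPassList

theorem topPass_label (top : Option (Table Dom)) (B : RTree (BotInfo m Dom)) :
    (topPass Q top B).val.label = ⟨B.label, top⟩ := by
  cases B
  rw [topPass]
  rfl

theorem topPassList_labels (p : BotInfo m Dom) (top : Option (Table Dom))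
    (left : List (Table Dom)) (cs : List (RTree (BotInfo m Dom))) :
    (topPassList Q p top left cs).val.map (fun c => c.label.toBotInfo) =
      cs.map fun c => c.label := by
  induction cs generalizing left with
  | nil => rw [topPassList]; rfl
  | cons c cs ih =>
    simp only [topPassList, Timed.val_step, Timed.val_bind, Timed.val_pure, List.map_cons, ih,
      topPass_label]

theorem topPass_nodes (top : Option (Table Dom)) (B : RTree (BotInfo m Dom)) :
    (topPass Q top B).val.nodes.map (fun v => v.idx) = B.nodes.map BotInfo.idx := by
  induction B using RTree.induction_on generalizing top with
  | node v cs ih =>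
    have nodesList_topPassList : ∀ left,
        (RTree.nodesList (topPassList Q v top left cs).val).map (fun v => v.idx) =
          (RTree.nodesList cs).map BotInfo.idx := by
      induction cs with
      | nil => intro left; rw [topPassList]; rfl
      | cons c cs ihcs =>
        intro left
        simp only [topPassList, Timed.val_step, Timed.val_bind, Timed.val_pure, RTree.nodesList,
          List.map_append, ih c List.mem_cons_self,
          ihcs fun c hc => ih c (List.mem_cons_of_mem _ hc)]
    simp only [topPass, Timed.val_step, Timed.val_bind, Timed.val_pure, RTree.nodes,
      List.map_cons, nodesList_topPassList]

/-- At every node of the tree, the topjoin and the botjoins of the children are at most `d` tables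
that together hold the message from all other relations. -/
inductive Calibrated (V : ∀ a, Finset (Dom a)) (D : Database Q Dom) (d : ℕ) :
    RTree (TopInfo m Dom) → Prop
  | node {v : TopInfo m Dom} {cs : List (RTree (TopInfo m Dom))} :
      Covers V D (Q v.idx) (v.top.toList ++ cs.map fun c => c.label.bot) {v.idx}ᶜ →
      v.top.toList.length + cs.length ≤ d →
      (∀ c ∈ cs, Calibrated V D d c) → Calibrated V D d (.node v cs)

variable {V : ∀ a, Finset (Dom a)} {D : Database Q Dom} {P : Finset (Fin k)} {i : Fin m}
  {c : RTree (Fin m)} {cs pre suf : List (RTree (Fin m))} {T : RTree (Fin m)}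
  {l : List (Table Dom)} {b : Table Dom}

theorem covers_others (hV : D.Within V) (hn : (RTree.node i cs).nodes.Nodup)
    (hr : RunningIntersection Q (.node i cs))
    (hl : Covers V D (Q i) l (RTree.node i cs).nodes.toFinsetᶜ) :
    Covers V D (Q i) (l ++ cs.map (botjoin D (Q i))) {i}ᶜ := by
  have hset : (RTree.node i cs).nodes.toFinsetᶜ ∪ (RTree.nodesList cs).toFinset = {i}ᶜ := by
    ext x
    have hi := (List.nodup_cons.1 hn).1
    simp only [RTree.nodes, List.toFinset_cons, Finset.mem_union, Finset.mem_compl,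
      Finset.mem_insert, List.mem_toFinset, Finset.mem_singleton]
    grind
  rw [← hset]
  refine hl.append (covers_botjoins hV hn hr (.refl cs)) (disjoint_compl_left.mono_right ?_)
  rw [RTree.nodes, List.toFinset_cons]
  exact Finset.subset_insert _ _

theorem covers_others_except_child (hV : D.Within V)
    (hn : (RTree.node i (pre ++ c :: suf)).nodes.Nodup)
    (hr : RunningIntersection Q (.node i (pre ++ c :: suf)))
    (hl : Covers V D (Q i) l (RTree.node i (pre ++ c :: suf)).nodes.toFinsetᶜ) :
    Covers V D (Q i) (l ++ (pre ++ suf).map (botjoin D (Q i))) (insert i c.nodes.toFinset)ᶜ := by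
  have hn' := hn
  rw [RTree.nodes, RTree.nodesList_eq_flatMap, List.flatMap_append, List.flatMap_cons,
    List.nodup_cons, List.nodup_append, List.nodup_append] at hn'
  have hset : (RTree.node i (pre ++ c :: suf)).nodes.toFinsetᶜ ∪
      (RTree.nodesList (pre ++ suf)).toFinset = (insert i c.nodes.toFinset)ᶜ := by
    ext x
    simp only [RTree.nodes, RTree.nodesList_eq_flatMap, List.flatMap_append, List.flatMap_cons,
      List.toFinset_cons, List.toFinset_append, Finset.mem_union, Finset.mem_compl,
      Finset.mem_insert, List.mem_toFinset]
    grind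
  rw [← hset]
  refine hl.append (covers_botjoins hV hn hr
    ((List.sublist_cons_self c suf).append_left pre)) (disjoint_compl_left.mono_right fun x => ?_)
  simp only [RTree.nodes, RTree.nodesList_eq_flatMap, List.flatMap_append, List.flatMap_cons,
    List.toFinset_cons, List.toFinset_append, Finset.mem_union, Finset.mem_insert,
    List.mem_toFinset]
  tauto

theorem covers_topjoin (hV : D.Within V) (hn : (RTree.node i (pre ++ c :: suf)).nodes.Nodup)
    (hr : RunningIntersection Q (.node i (pre ++ c :: suf)))
    (hl : Covers V D (Q i) l (RTree.node i (pre ++ c :: suf)).nodes.toFinsetᶜ) :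
    Covers V D (Q c.label) [(topjoin Q ⟨i, (countTable D i).val, b⟩
      (l ++ (pre ++ suf).map (botjoin D (Q i))) c.label).val] c.nodes.toFinsetᶜ := by
  have hc : c ∈ pre ++ c :: suf := by simp
  have separated : ∀ x ∉ c.nodes, ∀ y ∈ c.nodes, Q x ∩ Q y ⊆ Q i ∩ Q c.label := fun x hx y hy =>
    (Finset.inter_comm _ _).trans_subset (hr.separated c hc y hy x hx)
  have hrep := (covers_others_except_child hV hn hr hl).groupBy_joinFrom hV (P := Q c.label)
    (G := Q c.label ∩ Q i) (by simp) Finset.inter_subset_left (Finset.sdiff_inter_self_right _ _)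
    fun x hx => (separated x (fun h => by simp [h] at hx) _ c.label_mem_nodes).trans
      Finset.inter_subset_left
  have hset : insert i (insert i c.nodes.toFinset)ᶜ = c.nodes.toFinsetᶜ := by
    have hi : i ∈ c.nodes.toFinsetᶜ := by
      simpa using RTree.notMem_nodes_of_nodup_node hn hc
    rw [Finset.compl_insert, Finset.insert_erase hi]
  rw [hset] at hrep
  rw [← Finset.union_empty c.nodes.toFinsetᶜ]
  refine .cons hrep (fun x hx y hy => ?_) (Finset.disjoint_empty_right _) .nil
  exact (separated x (by simpa using hx) y (by simpa using hy)).trans Finset.inter_subset_right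

theorem topjoin_cost_le {d e : ℕ} (he : D.size ≤ 2 ^ e) (hpos : 0 < D.size * e)
    (hV : D.Within V) (hn : (RTree.node i (pre ++ c :: suf)).nodes.Nodup)
    (hr : RunningIntersection Q (.node i (pre ++ c :: suf)))
    (hl : Covers V D (Q i) l (RTree.node i (pre ++ c :: suf)).nodes.toFinsetᶜ)
    (hd : l.length + pre.length + suf.length + 1 ≤ d) :
    (topjoin Q ⟨i, (countTable D i).val, b⟩ (l ++ (pre ++ suf).map (botjoin D (Q i)))
      c.label).cost ≤ 31 * (d * (D.size * e)) := by
  refine ((covers_others_except_child hV hn hr hl).groupBy_joinFrom_cost_le (Q c.label ∩ Q i)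
    he hpos).trans ?_
  rw [← mul_assoc 31 d, List.length_append, List.length_map, List.length_append]
  exact Nat.mul_le_mul_right _ (by omega)

theorem topPass_calibrated (hV : D.Within V) {d : ℕ} {top : Option (Table Dom)}
    (hn : T.nodes.Nodup) (hr : RunningIntersection Q T)
    (htop : Covers V D (Q T.label) top.toList T.nodes.toFinsetᶜ)
    (hd : T.maxDegreeAux top.toList.length ≤ d) :
    Calibrated V D d (topPass Q top (botPass D P T).val).val := by
  induction T using RTree.induction_on generalizing P top with
  | node i cs ih =>
    simp only [botPass_val, topPass, Timed.val_step, Timed.val_bind, Timed.val_pure]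
    set children := (topPassList Q ⟨i, (countTable D i).val, botjoin D P (.node i cs)⟩ top []
      (cs.map fun c => (botPass D (Q i) c).val)).val with hchildren
    have hbots : children.map (fun c => c.label.bot) = cs.map (botjoin D (Q i)) := by
      have := congrArg (List.map BotInfo.bot) (topPassList_labels (Q := Q)
        ⟨i, (countTable D i).val, botjoin D P (.node i cs)⟩ top []
        (cs.map fun c => (botPass D (Q i) c).val))
      rwa [List.map_map, List.map_map, List.map_map] at this
    refine .node ?_ ?_ fun c' hc' => ?_
    · rw [hbots]
      exact covers_others hV hn hr htop
    · rw [← List.length_map (as := children), hbots, List.length_map, add_comm]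
      exact RTree.length_add_le_of_maxDegreeAux_le hd
    · obtain ⟨pre, c, suf, rfl, rfl⟩ := exists_of_mem_topPassList hc'
      have hc : c ∈ pre ++ c :: suf := by simp
      rw [botPass_label_idx]
      exact ih c hc (RTree.nodup_of_nodup_node hn hc) (hr.child c hc)
        (covers_topjoin hV hn hr htop) (RTree.maxDegreeAux_one_le hd c hc)

theorem topPass_cost_le (hV : D.Within V) {d e : ℕ} {top : Option (Table Dom)}
    (he : D.size ≤ 2 ^ e) (hpos : 0 < D.size * e) (hd₁ : 0 < d) (hn : T.nodes.Nodup)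
    (hr : RunningIntersection Q T)
    (htop : Covers V D (Q T.label) top.toList T.nodes.toFinsetᶜ)
    (hd : T.maxDegreeAux top.toList.length ≤ d) :
    (topPass Q top (botPass D P T).val).cost + 38 * (d * (D.size * e)) ≤
      40 * (d * (D.size * e)) * T.nodes.length := by
  induction T using RTree.induction_on generalizing P top with
  | node i cs ih =>
    have hunit : d ≤ d * (D.size * e) := Nat.le_mul_of_pos_right _ hpos
    have hlen := RTree.length_add_le_of_maxDegreeAux_le hd
    have hchildren := topPassList_cost_le (Q := Q)
      (p := ⟨i, (countTable D i).val, botjoin D P (.node i cs)⟩) (top := top) (left := [])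
      (f := fun c => (botPass D (Q i) c).val) (cs := cs)
      (K := fun c => 40 * (d * (D.size * e)) * c.nodes.length) fun pre c suf hcs => by
        subst hcs
        have hc : c ∈ pre ++ c :: suf := by simp
        rw [List.length_append, List.length_cons] at hlen
        have hjoin := topjoin_cost_le (b := botjoin D P (.node i (pre ++ c :: suf))) he hpos hV hn
          hr htop (by omega : top.toList.length + pre.length + suf.length + 1 ≤ d)
        have hchild := ih c hc (RTree.nodup_of_nodup_node hn hc) (hr.child c hc) (P := Q i)
          (top := some _) (covers_topjoin (b := botjoin D P (.node i (pre ++ c :: suf))) hV hn hr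
            htop) (RTree.maxDegreeAux_one_le hd c hc)
        rw [botPass_label_idx]
        change ([] : List (Table Dom)).length + pre.length + suf.length + 3 +
          (topjoin Q _ (top.toList ++ (pre ++ suf).map (botjoin D (Q i))) c.label).cost +
          (topPass Q (some (topjoin Q _ (top.toList ++ (pre ++ suf).map (botjoin D (Q i)))
            c.label).val) (botPass D (Q i) c).val).cost ≤ _
        rw [List.length_nil]
        omega
    simp only [botPass_val, topPass, Timed.cost_step, Timed.cost_bind, Timed.cost_pure]
    rw [List.sum_map_mul_left] at hchildren
    rw [RTree.length_nodes_node, mul_add, mul_one]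
    omega

end TopPass

/-! ### The multiplicity tables -/

section MultPass

variable {k m : ℕ} {Dom : Fin k → Type u} [∀ a, LinearOrder (Dom a)] {Q : Query k m}

/-- The second component holds the multiplicity table `T^i` of the relation `i` given by the first
component, that is, the message that all other relations send to `i`. -/
structure IsMultTable (V : ∀ a, Finset (Dom a)) (D : Database Q Dom) (d : ℕ)
    (p : Fin m × Table Dom) : Prop where
  schema_subset : p.2.schema ⊆ Q p.1
  nodup : (p.2.rows.map Prod.fst).Nodup
  weight_eq : p.2.weight = message V Q (relWeight D) (Q p.1) {p.1}ᶜ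
  length_le : 1 ≤ D.size → p.2.rows.length ≤ D.size ^ d

variable {V : ∀ a, Finset (Dom a)} {D : Database Q Dom} {i : Fin m} {l : List (Table Dom)}
  {X : Finset (Fin m)} {acc : List (Fin m × Table Dom)} {T : RTree (TopInfo m Dom)} {d e : ℕ}

theorem Covers.isMultTable (h : Covers V D (Q i) l {i}ᶜ) (hd : l.length ≤ d) :
    IsMultTable V D d (i, (groupBy (Q i) (joinAll l).val).val) where
  schema_subset := Finset.inter_subset_left
  nodup := groupBy_nodup _ _
  weight_eq := by
    have hschema : (joinAll l).val.schema ⊆ Q i :=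
      joinAll_schema_subset fun _ hR => (h.exists_represents hR).elim fun _ hR => hR.schema_subset
    rw [groupBy_weight (Q i) (joinAll_within fun _ => h.within),
      Finset.sdiff_eq_empty_iff_subset.2 hschema, marg_empty, joinAll_weight, h.prod_weight]
  length_le hn :=
    (groupBy_length_le _ _).trans (joinAll_length_le hn hd fun _ => h.length_le)

theorem Covers.groupBy_joinAll_cost_le (h : Covers V D (Q i) l X) (S : Finset (Fin k))
    (he : D.size ≤ 2 ^ e) (hn : 2 ≤ D.size) (hd₁ : 0 < d) (hd : l.length ≤ d) :
    (joinAll l).cost + (groupBy S (joinAll l).val).cost ≤ 31 * (d * e * D.size ^ d) := by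
  have hde : 0 < d * e := Nat.mul_pos hd₁ (pos_of_two_le_of_le_two_pow he hn)
  have hpow : D.size ≤ D.size ^ d := Nat.le_self_pow hd₁.ne' _
  have hpow_le : D.size ^ d ≤ d * e * D.size ^ d := Nat.le_mul_of_pos_left _ hde
  have hjoin := joinAll_cost_le he hn hd fun _ => h.length_le
  have hlen := joinAll_length_le (one_le_two.trans hn) hd fun _ => h.length_le
  have hexp : D.size ^ d ≤ 2 ^ (d * e) := by
    rw [mul_comm, pow_mul]
    exact Nat.pow_le_pow_left he d
  have hgroup := groupBy_cost_le S _ (hlen.trans hexp)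
  have hsort : (joinAll l).val.rows.length * (d * e) ≤ d * e * D.size ^ d := by
    rw [mul_comm]
    gcongr
  rw [mul_assoc] at hgroup
  omega

theorem multPass_map_fst (acc : List (Fin m × Table Dom)) (T : RTree (TopInfo m Dom)) :
    (multPass Q acc T).val.map Prod.fst = (T.nodes.map fun v => v.idx) ++ acc.map Prod.fst := by
  induction T using RTree.induction_on generalizing acc with
  | node v cs ih =>
    simp only [multPass, Timed.val_step, Timed.val_bind, Timed.val_pure, List.map_cons,
      RTree.nodes, List.cons_append]
    congr 1
    induction cs with
    | nil => rw [multPassList]; rfl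
    | cons c cs ih_cs =>
      rw [List.forall_mem_cons] at ih
      simp only [multPassList, Timed.val_step, Timed.val_bind, RTree.nodesList, List.map_append,
        List.append_assoc]
      rw [ih.1, ih_cs ih.2]

theorem multPass_isMultTable (hT : Calibrated V D d T) (hacc : ∀ p ∈ acc, IsMultTable V D d p) :
    ∀ p ∈ (multPass Q acc T).val, IsMultTable V D d p := by
  induction hT generalizing acc with
  | @node v cs hcovers hd hchildren ih =>
    simp only [multPass, Timed.val_step, Timed.val_bind, Timed.val_pure, mapT_val]
    refine List.forall_mem_cons.2 ⟨hcovers.isMultTable (by simpa using hd), ?_⟩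
    clear hcovers hd hchildren
    induction cs with
    | nil => rwa [multPassList]
    | cons c cs ih_cs =>
      rw [List.forall_mem_cons] at ih
      rw [multPassList]
      exact ih.1 (ih_cs ih.2)

theorem multPassList_cost_le {cs : List (RTree (TopInfo m Dom))} {K : RTree (TopInfo m Dom) → ℕ}
    (h : ∀ c ∈ cs, ∀ acc, (multPass Q acc c).cost ≤ K c) (acc : List (Fin m × Table Dom)) :
    (multPassList Q acc cs).cost ≤ (cs.map K).sum + cs.length + 1 := by
  induction cs with
  | nil => rw [multPassList]; exact le_rfl
  | cons c cs ih =>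
    rw [List.forall_mem_cons] at h
    have hc := h.1 (multPassList Q acc cs).val
    have hcs := ih h.2
    simp only [multPassList, Timed.cost_step, Timed.cost_bind, List.map_cons, List.sum_cons,
      List.length_cons]
    omega

theorem multPass_cost_le (he : D.size ≤ 2 ^ e) (hn : 2 ≤ D.size) (hd : 0 < d)
    (hT : Calibrated V D d T) (acc : List (Fin m × Table Dom)) :
    (multPass Q acc T).cost ≤ 36 * (d * e * D.size ^ d) * T.nodes.length := by
  induction hT generalizing acc with
  | @node v cs hcovers hlen _ ih =>
    have hunit : d ≤ d * e * D.size ^ d := by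
      rw [mul_assoc]
      exact Nat.le_mul_of_pos_right _
        (Nat.mul_pos (pos_of_two_le_of_le_two_pow he hn) (Nat.pow_pos (by omega)))
    have htable := hcovers.groupBy_joinAll_cost_le (Q v.idx) he hn hd (by simpa using hlen)
    have hchildren := multPassList_cost_le ih acc
    simp only [multPass, Timed.cost_step, Timed.cost_bind, Timed.cost_pure, mapT_val, mapT_cost]
    rw [List.sum_map_mul_left] at hchildren
    rw [RTree.length_nodes_node, mul_add, mul_one]
    omega

end MultPass

/-! ### Selecting the largest count -/

section Selection

variable {k m : ℕ} {Dom : Fin k → Type u} [∀ a, Inhabited (Dom a)] {Q : Query k m} {N : ℕ}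

theorem le_sens_bestRow (i : Fin m) {S : Finset (Fin k)} (best : Output Q Dom)
    (l : List (Tuple Dom S × ℕ)) : best.sens ≤ (bestRow i best l).val.sens ∧
      ∀ r ∈ l, r.2 ≤ (bestRow i best l).val.sens := by
  induction l generalizing best with
  | nil => simp [bestRow]
  | cons r l ih =>
    rw [bestRow, List.forall_mem_cons, Timed.val_step]
    split_ifs with h
    · have hr := ih ⟨r.2, ⟨i, r.1.extrapolate (Q i)⟩⟩
      exact ⟨h.le.trans hr.1, hr⟩
    · exact ⟨(ih best).1, (not_lt.1 h).trans (ih best).1, (ih best).2⟩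

theorem bestRow_eq_or_exists (i : Fin m) {S : Finset (Fin k)} (best : Output Q Dom)
    (l : List (Tuple Dom S × ℕ)) : (bestRow i best l).val = best ∨
      ∃ r ∈ l, (bestRow i best l).val = ⟨r.2, ⟨i, r.1.extrapolate (Q i)⟩⟩ := by
  induction l generalizing best with
  | nil => exact Or.inl rfl
  | cons r l ih =>
    rw [List.exists_mem_cons_iff, bestRow, Timed.val_step]
    split_ifs
    · exact Or.inr (ih _)
    · exact (ih best).imp_right Or.inr

theorem bestRow_cost (i : Fin m) {S : Finset (Fin k)} (best : Output Q Dom)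
    (l : List (Tuple Dom S × ℕ)) : (bestRow i best l).cost = l.length + 1 := by
  induction l generalizing best with
  | nil => rfl
  | cons r l ih => rw [bestRow, Timed.cost_step, ih, List.length_cons]

theorem le_sens_bestTable (best : Output Q Dom) (l : List (Fin m × Table Dom)) :
    best.sens ≤ (bestTable best l).val.sens ∧
      ∀ p ∈ l, ∀ r ∈ p.2.rows, r.2 ≤ (bestTable best l).val.sens := by
  induction l generalizing best with
  | nil => simp [bestTable]
  | cons p l ih =>
    have hrow := le_sens_bestRow p.1 best p.2.rows
    have hrest := ih (bestRow p.1 best p.2.rows).val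
    exact ⟨hrow.1.trans hrest.1,
      List.forall_mem_cons.2 ⟨fun r hr => (hrow.2 r hr).trans hrest.1, hrest.2⟩⟩

theorem bestTable_eq_or_exists (best : Output Q Dom) (l : List (Fin m × Table Dom)) :
    (bestTable best l).val = best ∨ ∃ p ∈ l, ∃ r ∈ p.2.rows,
      (bestTable best l).val = ⟨r.2, ⟨p.1, r.1.extrapolate (Q p.1)⟩⟩ := by
  induction l generalizing best with
  | nil => exact Or.inl rfl
  | cons p l ih =>
    rw [List.exists_mem_cons_iff, bestTable, Timed.val_step, Timed.val_bind]
    rcases ih (bestRow p.1 best p.2.rows).val with h | h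
    · rw [h]
      exact (bestRow_eq_or_exists p.1 best p.2.rows).imp_right Or.inl
    · exact Or.inr (Or.inr h)

theorem bestTable_cost_le (best : Output Q Dom) {l : List (Fin m × Table Dom)}
    (h : ∀ p ∈ l, p.2.rows.length ≤ N) : (bestTable best l).cost ≤ l.length * (N + 2) + 1 := by
  induction l generalizing best with
  | nil => simp [bestTable]
  | cons p l ih =>
    rw [List.forall_mem_cons] at h
    have hrest := ih (bestRow p.1 best p.2.rows).val h.2
    simp only [bestTable, Timed.cost_step, Timed.cost_bind, bestRow_cost, List.length_cons,
      add_mul, one_mul]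
    omega

end Selection

/-! ### Correctness and running time -/

section LSAcyclicJoin

variable {k m : ℕ} {Dom : Fin k → Type u} {Q : Query k m} {T : RTree (Fin m)}

theorem IsJoinTree.mem_nodes (hT : IsJoinTree Q T) (i : Fin m) : i ∈ T.nodes :=
  hT.nodes_perm.mem_iff.2 (List.mem_finRange i)

theorem IsJoinTree.length_nodes (hT : IsJoinTree Q T) : T.nodes.length = m := by
  rw [hT.nodes_perm.length_eq, List.length_finRange]

theorem IsJoinTree.maxDegree_pos (hT : IsJoinTree Q T) (hm : 2 ≤ m) : 0 < T.maxDegree := by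
  have hlen := hT.length_nodes
  obtain ⟨i, _ | ⟨c, cs⟩⟩ := T
  · rw [RTree.length_nodes_node, List.map_nil, List.sum_nil] at hlen
    omega
  · have := RTree.length_add_le_of_maxDegreeAux_le (le_refl (RTree.node i (c :: cs)).maxDegree)
    rw [List.length_cons] at this
    omega

variable [∀ a, LinearOrder (Dom a)] {D : Database Q Dom} {V : ∀ a, Finset (Dom a)}

theorem IsJoinTree.covers_compl_nodes (hT : IsJoinTree Q T) :
    Covers V D (Q T.label) (none : Option (Table Dom)).toList T.nodes.toFinsetᶜ := by
  have hset : T.nodes.toFinsetᶜ = ∅ := by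
    ext i
    simpa using hT.mem_nodes i
  rw [hset]
  exact .nil

/-- The result of the two passes over the tree `T` that compute the botjoins and the topjoins. -/
noncomputable def calibratedTree (T : RTree (Fin m)) (D : Database Q Dom) :
    RTree (TopInfo m Dom) :=
  (topPass Q none (botPass D (Q T.label) T).val).val

theorem calibratedTree_nodes (T : RTree (Fin m)) (D : Database Q Dom) :
    ((calibratedTree T D).nodes.map fun v => v.idx) = T.nodes := by
  rw [calibratedTree, topPass_nodes, botPass_nodes]

theorem IsJoinTree.calibrated (hT : IsJoinTree Q T) (hV : D.Within V) :
    Calibrated V D T.maxDegree (calibratedTree T D) :=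
  topPass_calibrated hV hT.nodup hT.runningIntersection hT.covers_compl_nodes le_rfl

/-- The multiplicity tables that the algorithm computes from the join tree `T`. -/
noncomputable def multTables (T : RTree (Fin m)) (D : Database Q Dom) :
    List (Fin m × Table Dom) :=
  (multPass Q [] (calibratedTree T D)).val

theorem multTables_map_fst (T : RTree (Fin m)) (D : Database Q Dom) :
    (multTables T D).map Prod.fst = T.nodes := by
  rw [multTables, multPass_map_fst, calibratedTree_nodes, List.map_nil, List.append_nil]

theorem IsJoinTree.isMultTable (hT : IsJoinTree Q T) (hV : D.Within V) :
    ∀ p ∈ multTables T D, IsMultTable V D T.maxDegree p :=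
  multPass_isMultTable (hT.calibrated hV) (by simp)

variable [∀ a, Inhabited (Dom a)]

/-- The values that occur in the database. For an attribute outside the schema of a nonempty
relation this includes the default value. -/
noncomputable def activeDomain (D : Database Q Dom) (a : Fin k) : Finset (Dom a) :=
  Finset.univ.biUnion fun j => (D j).toFinset.image fun t => t.extend a

theorem within_activeDomain (D : Database Q Dom) : D.Within (activeDomain D) := by
  intro j t ht a
  refine Finset.mem_biUnion.2 ⟨j, Finset.mem_univ j, Finset.mem_image.2
    ⟨t, List.mem_toFinset.2 ht, ?_⟩⟩
  exact dif_pos a.2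

theorem IsMultTable.tupleSens_eq_weight {d : ℕ} {p : Fin m × Table Dom} (hp : IsMultTable V D d p)
    (hV : D.Within V) (t : Tuple Dom (Q p.1)) :
    tupleSens D.toInstance ⟨p.1, t⟩ = p.2.weight t.extend := by
  rw [tupleSens_eq_message (D := D.toInstance) fun j t ht a => hV j t ht a, hp.weight_eq,
    ← Finset.compl_singleton]
  congr 1
  funext j σ
  exact Multiset.coe_count _ _

theorem lsAcyclicJoin_val (Q : Query k m) (T : RTree (Fin m)) (D : Database Q Dom) :
    (lsAcyclicJoin Q T D).val =
      (bestTable ⟨0, ⟨T.label, fun _ => default⟩⟩ (multTables T D)).val :=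
  rfl

theorem IsJoinTree.tupleSens_le_sens (hT : IsJoinTree Q T) (D : Database Q Dom)
    (t : Σ i, Tuple Dom (Q i)) :
    tupleSens D.toInstance t ≤ (lsAcyclicJoin Q T D).val.sens := by
  obtain ⟨i, t⟩ := t
  have hi : i ∈ (multTables T D).map Prod.fst := by
    rw [multTables_map_fst]
    exact hT.mem_nodes i
  obtain ⟨p, hp, rfl⟩ := List.mem_map.1 hi
  have htable := hT.isMultTable (within_activeDomain D) p hp
  rw [htable.tupleSens_eq_weight (within_activeDomain D)]
  rcases eq_or_ne (p.2.weight t.extend) 0 with hzero | hne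
  · exact hzero.trans_le (Nat.zero_le _)
  · obtain ⟨r, hr, hrt⟩ := Table.exists_mem_of_weight_ne_zero hne
    rw [Table.weight_eq_of_mem htable.nodup hr hrt]
    exact (le_sens_bestTable _ (multTables T D)).2 p hp r hr

theorem IsJoinTree.tupleSens_tuple (hT : IsJoinTree Q T) (D : Database Q Dom) :
    tupleSens D.toInstance (lsAcyclicJoin Q T D).val.tuple = (lsAcyclicJoin Q T D).val.sens := by
  have hle := hT.tupleSens_le_sens D (lsAcyclicJoin Q T D).val.tuple
  rw [lsAcyclicJoin_val] at hle ⊢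
  rcases bestTable_eq_or_exists (Q := Q) ⟨0, ⟨T.label, fun _ => default⟩⟩ (multTables T D) with
    h | ⟨p, hp, r, hr, h⟩
  · rw [h] at hle ⊢
    exact Nat.le_zero.1 hle
  · have htable := hT.isMultTable (within_activeDomain D) p hp
    rw [h, htable.tupleSens_eq_weight (within_activeDomain D)]
    refine Table.weight_eq_of_mem htable.nodup hr (Tuple.eq_ofAssignment_iff.2 fun a ha => ?_)
    simp [Tuple.extend, Tuple.extrapolate, htable.schema_subset ha, ha]

theorem lsAcyclicJoin_cost (Q : Query k m) (T : RTree (Fin m)) (D : Database Q Dom) :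
    (lsAcyclicJoin Q T D).cost = (botPass D (Q T.label) T).cost +
      ((topPass Q none (botPass D (Q T.label) T).val).cost +
      ((multPass Q [] (calibratedTree T D)).cost +
      (bestTable (Q := Q) ⟨0, ⟨T.label, fun _ => default⟩⟩ (multTables T D)).cost)) + 1 :=
  rfl

theorem IsJoinTree.bestTable_multTables_cost_le (hT : IsJoinTree Q T) (hn : 1 ≤ D.size)
    (best : Output Q Dom) :
    (bestTable best (multTables T D)).cost ≤ 3 * D.size ^ T.maxDegree * m + 1 := by
  have hlen : (multTables T D).length = m := by
    rw [← List.length_map (f := Prod.fst), multTables_map_fst, hT.length_nodes]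
  have hcost := bestTable_cost_le best fun p hp =>
    (hT.isMultTable (within_activeDomain D) p hp).length_le hn
  have hpow : D.size ^ T.maxDegree + 2 ≤ 3 * D.size ^ T.maxDegree := by
    have := Nat.one_le_pow T.maxDegree _ hn
    omega
  rw [hlen] at hcost
  rw [mul_comm _ m]
  exact hcost.trans (Nat.add_le_add_right (Nat.mul_le_mul_left m hpow) 1)

theorem IsJoinTree.lsAcyclicJoin_cost_le (hT : IsJoinTree Q T) (D : Database Q Dom) (hm : 2 ≤ m)
    (hn : 2 ≤ D.size) {e : ℕ} (he : D.size ≤ 2 ^ e) :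
    (lsAcyclicJoin Q T D).cost ≤ 131 * (T.maxDegree * e * D.size ^ T.maxDegree) * m := by
  have hd := hT.maxDegree_pos hm
  have hV := within_activeDomain D
  have he₁ := pos_of_two_le_of_le_two_pow he hn
  have hpos : 0 < D.size * e := Nat.mul_pos (by omega) he₁
  have hbot := botPass_cost_le (P := Q T.label) (b := 0) hV he hpos hd hT.nodup
    hT.runningIntersection le_rfl
  have htop := topPass_cost_le (P := Q T.label) hV he hpos hd hT.nodup hT.runningIntersection
    hT.covers_compl_nodes le_rfl
  have hmult := multPass_cost_le he hn hd (hT.calibrated hV) []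
  have hbest := hT.bestTable_multTables_cost_le (D := D) (by omega)
    ⟨0, ⟨T.label, fun _ => default⟩⟩
  have hlen : (calibratedTree T D).nodes.length = m := by
    rw [← List.length_map (f := fun v => v.idx), calibratedTree_nodes, hT.length_nodes]
  rw [hT.length_nodes] at hbot htop
  rw [hlen] at hmult
  have hlinear : T.maxDegree * (D.size * e) * m ≤
      T.maxDegree * e * D.size ^ T.maxDegree * m := by
    rw [mul_comm D.size, ← mul_assoc]
    gcongr
    exact Nat.le_self_pow hd.ne' _
  have hpow : D.size ^ T.maxDegree * m ≤ T.maxDegree * e * D.size ^ T.maxDegree * m :=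
    Nat.mul_le_mul_right m (Nat.le_mul_of_pos_left _ (Nat.mul_pos hd he₁))
  have hunit : 1 ≤ T.maxDegree * e * D.size ^ T.maxDegree * m :=
    Nat.mul_pos (Nat.mul_pos (Nat.mul_pos hd he₁) (Nat.pow_pos (by omega))) (by omega)
  rw [lsAcyclicJoin_cost]
  simp only [mul_assoc 50, mul_assoc 40, mul_assoc 36, mul_assoc 3, mul_assoc 131]
    at hbot htop hmult hbest ⊢
  omega

theorem natLog_two_add_one_le {n : ℕ} (hn : 2 ≤ n) :
    ((Nat.log 2 n + 1 : ℕ) : ℝ) ≤ 3 * Real.log n := by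
  have hone : (1 : ℝ) ≤ Nat.log 2 n := by exact_mod_cast Nat.log_pos one_lt_two hn
  have hlogb : (Nat.log 2 n : ℝ) ≤ Real.logb 2 n := by exact_mod_cast Real.natLog_le_logb n 2
  have hmul : Real.logb 2 n * Real.log 2 = Real.log n :=
    div_mul_cancel₀ _ (Real.log_pos one_lt_two).ne'
  have htwo : 2 / 3 < Real.log 2 := by linarith [Real.log_two_gt_d9]
  push_cast
  nlinarith

end LSAcyclicJoin

end LSJoin

theorem mainTheorem2 :
    ∃ C : ℝ, ∀ (k m : ℕ) (Dom : Fin k → Type u) [∀ a, LinearOrder (Dom a)]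
      [∀ a, Inhabited (Dom a)] (Q : LSJoin.Query k m), 0 < m →
      (Q.IsAcyclic → ∃ T : LSJoin.RTree (Fin m), LSJoin.GYOTree Q Finset.univ T) ∧
      (∀ T : LSJoin.RTree (Fin m), LSJoin.GYOTree Q Finset.univ T → LSJoin.IsJoinTree Q T) ∧
      ∀ T : LSJoin.RTree (Fin m), LSJoin.IsJoinTree Q T →
        ∀ D : LSJoin.Database Q Dom,
          LSJoin.IsLocalSensitivity D.toInstance (LSJoin.lsAcyclicJoin Q T D).val.sens ∧
          LSJoin.tupleSens D.toInstance (LSJoin.lsAcyclicJoin Q T D).val.tuple =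
            (LSJoin.lsAcyclicJoin Q T D).val.sens ∧
          (2 ≤ m → 2 ≤ D.size →
            ((LSJoin.lsAcyclicJoin Q T D).cost : ℝ) ≤
              C * m * T.maxDegree * (D.size : ℝ) ^ T.maxDegree * Real.log D.size) := by
  refine ⟨393, fun k m Dom _ _ Q hm => ⟨fun h => h.exists_gyoTree ⟨⟨0, hm⟩, Finset.mem_univ _⟩,
    fun T hT => hT.isJoinTree, fun T hT D => ⟨⟨⟨_, hT.tupleSens_tuple D⟩, ?_⟩,
      hT.tupleSens_tuple D, fun hm₂ hn => ?_⟩⟩⟩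
  · rintro _ ⟨t, rfl⟩
    exact hT.tupleSens_le_sens D t
  · have hcost := hT.lsAcyclicJoin_cost_le D hm₂ hn
      (Nat.lt_pow_succ_log_self one_lt_two D.size).le
    calc ((LSJoin.lsAcyclicJoin Q T D).cost : ℝ)
        ≤ ((131 * (T.maxDegree * (Nat.log 2 D.size + 1) * D.size ^ T.maxDegree) * m : ℕ) : ℝ) :=
          Nat.cast_le.2 hcost
      _ = 131 * m * T.maxDegree * (D.size : ℝ) ^ T.maxDegree *
            ((Nat.log 2 D.size + 1 : ℕ) : ℝ) := by
          push_cast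
          ring
      _ ≤ 131 * m * T.maxDegree * (D.size : ℝ) ^ T.maxDegree * (3 * Real.log D.size) := by
          gcongr
          exact LSJoin.natLog_two_add_one_le hn
      _ = 393 * m * T.maxDegree * (D.size : ℝ) ^ T.maxDegree * Real.log D.size := by ring
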